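/- All graphs are finite and simple. For an integer $k\ge 0$ let $\mathcal D_k$ be the class of graphs all of whose minors have minimum degree at most $k$, and let $\widehat{\mathcal D}_k$ be the class of minimal forbidden minors of $\mathcal D_k$, that is, of the graphs that are not in $\mathcal D_k$ but all of whose proper minors are in $\mathcal D_k$. For a connected graph $G$, the blocks of $G$ are its cut-edges and its maximal 2-connected subgraphs; the block decomposition tree of $G$ has as vertices the blocks and the cut-vertices of $G$, a block $b$ being adjacent to a cut-vertex $c$ whenever $b$ contains $c$. A block decomposition tree is a tree isomorphic to the block decomposition tree of some connected graph. **Theorem.** For every block decomposition tree $T$ there is a connected graph $G$ such that 1. $T$ is (isomorphic to) the block decomposition tree of $G$; 2. $\delta(G)\ge 1$ and $G\in\widehat{\mathcal D}_{d-1}$, where $d=\delta(G)$ is the minimum degree of $G$; 3. if $T$ has at least one edge, then $\delta(G)\le 8|E(T)|$, and $G$ has (vertex-)connectivity exactly $1$. Hence minor-minimal minimum-degree graphs can have arbitrary block structure, including connectivity $1$. -/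

import Mathlib

namespace BlockStructure

universe u v

/-! ### Minors and the classes `𝒟_k`, `𝒟̂_k` -/

/-- `H` is a minor of `G`: a graph isomorphic to `H` is obtained from a subgraph of `G` by
contracting edges. The set `B w` is the branch set of the vertex `w` of `H`: branch sets are
non-empty, connected and pairwise disjoint, and every edge of `H` comes from an edge of `G`
between the two branch sets. -/
def IsMinor {W : Type v} {V : Type u} (H : SimpleGraph W) (G : SimpleGraph V) : Prop :=
  ∃ B : W → Set V,
    (∀ w, (G.induce (B w)).Connected) ∧
    (∀ w w', w ≠ w' → Disjoint (B w) (B w')) ∧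
    ∀ w w', H.Adj w w' → ∃ x ∈ B w, ∃ y ∈ B w', G.Adj x y

/-- A proper minor of `G` is a minor of `G` that is not isomorphic to `G`. -/
def IsProperMinor {W : Type v} {V : Type u} (H : SimpleGraph W) (G : SimpleGraph V) : Prop :=
  IsMinor H G ∧ IsEmpty (H ≃g G)

/-- `G ∈ 𝒟_k`: every minor of the (finite) graph `G` has minimum degree at most `k`. -/
def MemD (k : ℕ) {V : Type u} (G : SimpleGraph V) : Prop :=
  ∀ (W : Type u) [Fintype W] (H : SimpleGraph W) [DecidableRel H.Adj],
    IsMinor H G → H.minDegree ≤ k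

/-- `G ∈ 𝒟̂_k`: the (finite) graph `G` is a minimal forbidden minor of `𝒟_k`, that is, `G` is not
in `𝒟_k`, but every proper minor of `G` is in `𝒟_k`. -/
def MemDHat (k : ℕ) {V : Type u} (G : SimpleGraph V) : Prop :=
  ¬ MemD k G ∧
    ∀ (W : Type u) [Fintype W] (H : SimpleGraph W), IsProperMinor H G → MemD k H

/-! ### Blocks, cut-vertices and block decomposition trees -/

section Blocks

variable {V : Type u} (G : SimpleGraph V)

/-- `c` is a cut-vertex of `G`: deleting `c` separates two vertices of a component of `G`. -/
def IsCutVertex (c : V) : Prop :=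
  ∃ a b : ({c}ᶜ : Set V), G.Reachable a b ∧ ¬ (G.induce ({c}ᶜ : Set V)).Reachable a b

/-- The subgraph `B` of `G` is 2-connected: it has at least three vertices, it is connected, and it
stays connected when any one of its vertices is deleted. -/
def IsTwoConnected {V : Type u} {G : SimpleGraph V} (B : G.Subgraph) : Prop :=
  3 ≤ B.verts.encard ∧ B.Connected ∧ ∀ x ∈ B.verts, (B.deleteVerts {x}).Connected

/-- A block of `G` is a cut-edge of `G` (with its two ends) or a maximal 2-connected subgraph
of `G`. -/
def IsBlock (B : G.Subgraph) : Prop :=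
  (∃ (x y : V) (h : G.Adj x y), G.IsBridge s(x, y) ∧ B = G.subgraphOfAdj h) ∨
    Maximal IsTwoConnected B

/-- The block decomposition tree of a (connected) graph `G`. Its vertices are the blocks and the
cut-vertices of `G`; a block `B` is adjacent to a cut-vertex `c` whenever `B` contains `c`. -/
def blockTree : SimpleGraph ({B : G.Subgraph // IsBlock G B} ⊕ {c : V // IsCutVertex G c}) where
  Adj
    | .inl B, .inr c => c.1 ∈ B.1.verts
    | .inr c, .inl B => c.1 ∈ B.1.verts
    | _, _ => False
  symm := ⟨by rintro (B | c) (B' | c') h <;> exact h⟩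
  loopless := ⟨by rintro (B | c) h <;> exact h⟩

end Blocks

/-- `T` is the block decomposition tree of the connected graph `G` (up to isomorphism). -/
def IsBlockTreeOf {V : Type u} {W : Type v} (T : SimpleGraph V) (G : SimpleGraph W) : Prop :=
  G.Connected ∧ Nonempty (T ≃g blockTree G)

/-- A block decomposition tree is a tree that is isomorphic to the block decomposition tree of some
finite connected graph. -/
def IsBlockDecompositionTree {V : Type u} (T : SimpleGraph V) : Prop :=
  T.IsTree ∧ ∃ (W : Type) (_ : Finite W) (H : SimpleGraph W), IsBlockTreeOf T H

/-- The (vertex-)connectivity of a finite graph `G`: the least number of vertices whose deletion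
leaves a disconnected graph or a graph with at most one vertex. -/
noncomputable def vertexConnectivity {V : Type u} (G : SimpleGraph V) : ℕ :=
  sInf {k | ∃ S : Finset V, S.card = k ∧
    (¬ (G.induce ((S : Set V)ᶜ)).Preconnected ∨ ((S : Set V)ᶜ).Subsingleton)}

end BlockStructure

/-!
A tree with one vertex is the block decomposition tree of `K₂`. For a tree `T` with `m ≥ 1` edges
let `d = 6 * m`, and let every block `b` have `d + 2` vertices, the cut-vertices adjacent to `b` in
`T` among them. A vertex of `b` that is not a cut-vertex is joined to all other vertices of `b` but
one, and a cut-vertex `c` of `b` is joined to `6 * s` vertices of `b`, where `s` is the size of the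
component of `b` in `T - bc`. For a fixed `c` these components partition `T - c`, which has `m`
vertices, so the graph is `d`-regular.

Consider a minor of minimum degree at least `d`. A branch set that meets a block but contains none
of its cut-vertices lies inside the block, so at least `d + 1` branch sets meet the block, and the
degree condition then forces all `d + 2` vertices of the block into distinct branch sets; say that
the block splits. Some block splits, since otherwise every branch set contains a cut-vertex and
there are too few branch sets. Let `w` be the branch set of a cut-vertex `c`. It cannot continue
into a block that splits at one of its cut-vertices, and there it has at most 6 neighbours for every
vertex of `T` cut off. If `c` were also in a block that does not split, all other neighbours of `w`
would contain cut-vertices that are not cut off, and `w` would have fewer than `d` neighbours. So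
splitting passes along the tree from block to block, and all branch sets are singletons. A minor of
minimum degree at least `d` thus has as many vertices as the `d`-regular graph, hence is the graph
itself.
-/

namespace BlockStructure

/-! ### Sides of an edge of a tree -/

section Side

variable {V : Type*} {T : SimpleGraph V}

/-- The vertices of `T` that are nearer to `u` than to `v`. For an edge `uv` of a tree this is the
component of `u` in the graph obtained by deleting that edge. -/
def side (T : SimpleGraph V) (u v : V) : Set V := {x | T.dist x u < T.dist x v}

lemma mem_side {u v x : V} : x ∈ side T u v ↔ T.dist x u < T.dist x v := Iff.rfl

lemma mem_side_or_mem_side (hT : T.IsTree) {u v : V} (h : T.Adj u v) (x : V) :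
    x ∈ side T u v ∨ x ∈ side T v u :=
  lt_or_gt_of_ne (hT.dist_ne_of_adj x h)

lemma disjoint_side_swap (u v : V) : Disjoint (side T u v) (side T v u) :=
  Set.disjoint_left.2 fun _ h h' => lt_asymm (mem_side.1 h) (mem_side.1 h')

lemma notMem_side {u v x : V} (h : x ∈ side T u v) : x ∉ side T v u :=
  Set.disjoint_left.1 (disjoint_side_swap u v) h

lemma self_mem_side {u v : V} (h : T.Adj u v) : u ∈ side T u v := by
  simp [mem_side, SimpleGraph.dist_eq_one_iff_adj.2 h]

lemma self_notMem_side (u v : V) : v ∉ side T u v := by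
  simp [mem_side]

lemma exists_adj_mem_side (hT : T.IsTree) {x v : V} (h : x ≠ v) :
    ∃ u, T.Adj v u ∧ x ∈ side T u v := by
  obtain ⟨p, -, hp⟩ := hT.connected.exists_path_of_dist v x
  cases p with
  | nil => exact absurd rfl h
  | @cons _ u _ hadj q =>
    refine ⟨u, hadj, ?_⟩
    have := T.dist_le q
    rw [SimpleGraph.Walk.length_cons] at hp
    rw [mem_side, T.dist_comm, T.dist_comm (u := x)]
    omega

lemma eq_penultimate_of_mem_side (hT : T.IsTree) {x v u : V} (h : T.Adj v u)
    (hx : x ∈ side T u v) {p : T.Walk x v} (hp : p.IsPath) : u = p.penultimate := by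
  refine hT.isAcyclic.eq_penultimate_of_adj_end hp h ?_
  by_contra hns
  obtain ⟨q, hq, hqd⟩ := hT.connected.exists_path_of_dist x u
  have hqp : q = p.concat h := (hT.existsUnique_path x u).unique hq (hp.concat hns h)
  have := T.dist_le p
  rw [hqp, SimpleGraph.Walk.length_concat] at hqd
  rw [mem_side] at hx
  omega

lemma eq_of_mem_side (hT : T.IsTree) {x v u u' : V} (h : T.Adj v u) (h' : T.Adj v u')
    (hx : x ∈ side T u v) (hx' : x ∈ side T u' v) : u = u' := by
  obtain ⟨p, hp, -⟩ := hT.connected.exists_path_of_dist x v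
  rw [eq_penultimate_of_mem_side hT h hx hp, eq_penultimate_of_mem_side hT h' hx' hp]

lemma eq_of_adj_of_mem_side (hT : T.IsTree) {u v p q : V} (h : T.Adj u v) (hpq : T.Adj p q)
    (hp : p ∈ side T u v) (hq : q ∈ side T v u) : p = u ∧ q = v := by
  have h1 := hT.dist_eq_dist_add_one_of_adj p h
  have h2 := hT.dist_eq_dist_add_one_of_adj q h
  have h3 := hT.dist_eq_dist_add_one_of_adj u hpq
  have h4 := hT.dist_eq_dist_add_one_of_adj v hpq
  rw [mem_side] at hp hq
  rw [T.dist_comm (u := u), T.dist_comm (u := u)] at h3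
  rw [T.dist_comm (u := v), T.dist_comm (u := v)] at h4
  obtain rfl | hpu := eq_or_ne p u
  · rw [T.dist_self] at *
    exact ⟨rfl, hT.connected.dist_eq_zero_iff.1 (by omega)⟩
  · exfalso
    obtain ⟨r, hr, hur⟩ := exists_adj_mem_side hT hpu.symm
    rw [mem_side, T.dist_comm, T.dist_comm (u := u)] at hur
    have h5 := hT.dist_eq_dist_add_one_of_adj r h
    have h6 := hT.dist_eq_dist_add_one_of_adj v hr
    rw [T.dist_comm (u := v), T.dist_comm (u := v)] at h6
    have hrq : r = q := by
      refine eq_of_mem_side hT (x := v) hr hpq ?_ ?_ <;>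
        rw [mem_side, T.dist_comm, T.dist_comm (u := v)] <;> omega
    subst hrq
    omega

lemma dist_add_dist_of_mem_side (hT : T.IsTree) {u v x y : V} (h : T.Adj u v)
    (hx : x ∈ side T u v) (hy : y ∈ side T v u) : T.dist x v + T.dist v y = T.dist x y := by
  classical
  obtain ⟨p, -, hp⟩ := hT.connected.exists_path_of_dist x y
  obtain ⟨d, hd, hfst, hsnd⟩ := p.exists_boundary_dart (side T u v) hx (notMem_side hy)
  have hdv : d.snd = v := (eq_of_adj_of_mem_side hT h d.adj hfst
    ((mem_side_or_mem_side hT h _).resolve_left hsnd)).2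
  have hv : v ∈ p.support := hdv ▸ p.dart_snd_mem_support_of_mem_darts hd
  refine le_antisymm ?_ hT.connected.dist_triangle
  calc T.dist x v + T.dist v y ≤ (p.takeUntil v hv).length + (p.dropUntil v hv).length :=
        add_le_add (T.dist_le _) (T.dist_le _)
    _ = T.dist x y := by rw [← SimpleGraph.Walk.length_append, p.take_spec hv, hp]

lemma disjoint_side (hT : T.IsTree) {u v u' v' : V} (h : T.Adj u v) (h' : T.Adj u' v')
    (hv' : v' ∈ side T v u) (hv : v ∈ side T v' u') (hne : v = v' → u ≠ u') :
    Disjoint (side T u v) (side T u' v') := by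
  refine Set.disjoint_left.2 fun x hx hx' => ?_
  have h1 := dist_add_dist_of_mem_side hT h hx hv'
  have h2 := dist_add_dist_of_mem_side hT h' hx' hv
  have hvv' : v = v' := hT.connected.dist_eq_zero_iff.1 (by omega)
  subst hvv'
  exact hne rfl (eq_of_mem_side hT h.symm h'.symm hx hx')

lemma ncard_side_add_ncard_side [Finite V] (hT : T.IsTree) {u v : V} (h : T.Adj u v) :
    (side T u v).ncard + (side T v u).ncard = Nat.card V := by
  have huniv : side T u v ∪ side T v u = Set.univ :=
    Set.eq_univ_of_forall (mem_side_or_mem_side hT h)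
  rw [← Set.ncard_union_eq (disjoint_side_swap u v), huniv, Set.ncard_univ]

lemma sum_ncard_side_add_one [Finite V] (hT : T.IsTree) (v : V) {ι : Type*} [Fintype ι]
    {f : ι → V} (hf : f.Injective) (hfv : Set.range f = T.neighborSet v) :
    ∑ i, (side T (f i) v).ncard + 1 = Nat.card V := by
  have hadj (i : ι) : T.Adj v (f i) := hfv.le (Set.mem_range_self i)
  have hdisj : Pairwise (Function.onFun Disjoint fun i => side T (f i) v) := fun i j hij =>
    Set.disjoint_left.2 fun x hx hx' => hij (hf (eq_of_mem_side hT (hadj i) (hadj j) hx hx'))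
  have hunion : ⋃ i, side T (f i) v = {v}ᶜ := by
    ext x
    rw [Set.mem_iUnion, Set.mem_compl_singleton_iff]
    refine ⟨fun ⟨i, hi⟩ hxv => self_notMem_side (f i) v (hxv ▸ hi), fun hx => ?_⟩
    obtain ⟨u, hu, hxu⟩ := exists_adj_mem_side hT hx
    obtain ⟨i, rfl⟩ := hfv.ge hu
    exact ⟨i, hxu⟩
  rw [← finsum_eq_sum_of_fintype, ← Set.ncard_iUnion_of_finite (fun _ => Set.toFinite _) hdisj,
    hunion, add_comm, ← Set.ncard_singleton v, Set.ncard_add_ncard_compl]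

end Side

/-! ### Connected sets of vertices -/

section ConnectedSet

variable {V : Type*} {G : SimpleGraph V}

lemma exists_adj_boundary {S : Set V} (hS : (G.induce S).Connected) {A : Set V} {x y : V}
    (hx : x ∈ S) (hxA : x ∈ A) (hy : y ∈ S) (hyA : y ∉ A) :
    ∃ u ∈ S, ∃ v ∈ S, G.Adj u v ∧ u ∈ A ∧ v ∉ A := by
  obtain ⟨p⟩ := hS.preconnected ⟨x, hx⟩ ⟨y, hy⟩
  obtain ⟨d, -, h1, h2⟩ := p.exists_boundary_dart (Subtype.val ⁻¹' A) hxA hyA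
  exact ⟨d.fst, d.fst.2, d.snd, d.snd.2, d.adj, h1, h2⟩

lemma connected_induce_iff_boundary {S : Set V} :
    (G.induce S).Connected ↔ S.Nonempty ∧
      ∀ A : Set V, (∃ x ∈ S, x ∈ A) → (∃ y ∈ S, y ∉ A) →
        ∃ u ∈ S, ∃ v ∈ S, G.Adj u v ∧ u ∈ A ∧ v ∉ A := by
  refine ⟨fun h => ⟨Set.nonempty_coe_sort.1 h.nonempty, ?_⟩, ?_⟩
  · rintro A ⟨x, hx, hxA⟩ ⟨y, hy, hyA⟩
    exact exists_adj_boundary h hx hxA hy hyA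
  · rintro ⟨⟨x, hx⟩, h⟩
    rw [SimpleGraph.connected_iff_exists_forall_reachable]
    refine ⟨⟨x, hx⟩, ?_⟩
    by_contra! hne
    obtain ⟨⟨y, hy⟩, hxy⟩ := hne
    obtain ⟨u, hu, v, hv, huv, ⟨hu', hxu⟩, hvA⟩ :=
      h {z | ∃ hz : z ∈ S, (G.induce S).Reachable ⟨x, hx⟩ ⟨z, hz⟩}
        ⟨x, hx, hx, SimpleGraph.Reachable.refl _⟩ ⟨y, hy, fun ⟨_, h⟩ => hxy h⟩
    have huv' : (G.induce S).Adj ⟨u, hu⟩ ⟨v, hv⟩ := huv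
    exact hvA ⟨hv, hxu.trans huv'.reachable⟩

lemma isCutVertex_of_boundary (hG : G.Connected) {A : Set V} {c : V}
    (hA : ∀ x ∈ A, ∀ y ∉ A, G.Adj x y → y = c) {a b : V} (ha : a ∈ A) (hac : a ≠ c) (hb : b ∉ A)
    (hbc : b ≠ c) : IsCutVertex G c := by
  refine ⟨⟨a, hac⟩, ⟨b, hbc⟩, hG.preconnected a b, fun ⟨p⟩ => ?_⟩
  obtain ⟨d, -, h1, h2⟩ := p.exists_boundary_dart (Subtype.val ⁻¹' A) ha hb
  exact d.snd.2 (hA _ h1 _ h2 d.adj)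

lemma vertexConnectivity_eq_one (hG : G.Connected) {c : V} (hc : IsCutVertex G c) :
    vertexConnectivity G = 1 := by
  obtain ⟨a, b, -, hab⟩ := hc
  have hmem : 1 ∈ {k | ∃ S : Finset V, S.card = k ∧
      (¬ (G.induce ((S : Set V)ᶜ)).Preconnected ∨ ((S : Set V)ᶜ).Subsingleton)} := by
    refine ⟨{c}, Finset.card_singleton c, Or.inl fun h => hab ?_⟩
    rw [Finset.coe_singleton] at h
    exact h a b
  refine le_antisymm (Nat.sInf_le hmem) (Nat.one_le_iff_ne_zero.2 fun h0 => ?_)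
  obtain ⟨S, hS, h⟩ := (Nat.sInf_eq_zero.1 h0).resolve_right (Set.nonempty_of_mem hmem).ne_empty
  rw [Finset.card_eq_zero.1 hS, Finset.coe_empty, Set.compl_empty] at h
  rcases h with h | h
  · exact h ((SimpleGraph.induceUnivIso G).connected_iff.2 hG).preconnected
  · exact hab (by rw [Subtype.ext (h (Set.mem_univ a.1) (Set.mem_univ b.1))])

end ConnectedSet

/-! ### 2-connected subgraphs and blocks -/

section TwoConnected

variable {V : Type*} {G : SimpleGraph V}

lemma IsTwoConnected.connected_induce_sdiff {B : G.Subgraph} (hB : IsTwoConnected B) (c : V) :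
    (G.induce (B.verts \ {c})).Connected := by
  by_cases hc : c ∈ B.verts
  · exact (hB.2.2 c hc).induce_verts
  · rw [Set.sdiff_singleton_eq_self hc]
    exact hB.2.1.induce_verts

lemma IsTwoConnected.verts_subset_of_boundary {B : G.Subgraph} (hB : IsTwoConnected B)
    {A : Set V} {c v : V} (hA : ∀ x ∈ A, ∀ y ∉ A, G.Adj x y → y = c) (hv : v ∈ B.verts)
    (hvA : v ∈ A) (hvc : v ≠ c) : B.verts ⊆ insert c A := by
  intro y hy
  by_contra hyA
  rw [Set.mem_insert_iff, not_or] at hyA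
  obtain ⟨p, -, q, hq, hpq, hp, hqA⟩ :=
    exists_adj_boundary (hB.connected_induce_sdiff c) ⟨hv, hvc⟩ hvA ⟨hy, hyA.1⟩ hyA.2
  exact hq.2 (hA p hp q hqA hpq)

lemma IsTwoConnected.exists_adj {B : G.Subgraph} (hB : IsTwoConnected B) :
    ∃ x ∈ B.verts, ∃ y ∈ B.verts, G.Adj x y := by
  obtain ⟨s, t, hs, ht, hst⟩ := Set.one_lt_encard_iff.1 (lt_of_lt_of_le (by norm_num) hB.1)
  obtain ⟨x, hx, y, hy, hxy, -⟩ :=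
    exists_adj_boundary hB.2.1.induce_verts hs (Set.mem_singleton s) ht hst.symm
  exact ⟨x, hx, y, hy, hxy⟩

lemma connected_of_forall_exists_le {K : G.Subgraph} (hne : K.verts.Nonempty)
    (h : ∀ a ∈ K.verts, ∀ b ∈ K.verts, ∃ B ≤ K, B.Connected ∧ a ∈ B.verts ∧ b ∈ B.verts) :
    K.Connected := by
  rw [SimpleGraph.Subgraph.connected_iff, SimpleGraph.Subgraph.preconnected_iff]
  refine ⟨fun ⟨a, ha⟩ ⟨b, hb⟩ => ?_, hne⟩
  obtain ⟨B, hBK, hB, haB, hbB⟩ := h a ha b hb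
  exact (hB ⟨a, haB⟩ ⟨b, hbB⟩).map (SimpleGraph.Subgraph.inclusion hBK)

lemma isTwoConnected_sSup {F : Set G.Subgraph} (hF : IsChain (· ≤ ·) F) (hne : F.Nonempty)
    (h : ∀ B ∈ F, IsTwoConnected B) : IsTwoConnected (sSup F) := by
  obtain ⟨B₀, hB₀⟩ := hne
  have hdir (a b : V) (ha : a ∈ (sSup F).verts) (hb : b ∈ (sSup F).verts) :
      ∃ B ∈ F, a ∈ B.verts ∧ b ∈ B.verts := by
    simp only [SimpleGraph.Subgraph.verts_sSup, Set.mem_iUnion₂] at ha hb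
    obtain ⟨A, hA, haA⟩ := ha
    obtain ⟨B, hB, hbB⟩ := hb
    rcases hF.total hA hB with hle | hle
    · exact ⟨B, hB, hle.1 haA, hbB⟩
    · exact ⟨A, hA, haA, hle.1 hbB⟩
  refine ⟨(h B₀ hB₀).1.trans (Set.encard_le_encard (le_sSup hB₀).1), ?_, fun x hx => ?_⟩
  · refine connected_of_forall_exists_le ((h B₀ hB₀).2.1.nonempty.mono (le_sSup hB₀).1)
      fun a ha b hb => ?_
    obtain ⟨B, hB, haB, hbB⟩ := hdir a b ha hb
    exact ⟨B, le_sSup hB, (h B hB).2.1, haB, hbB⟩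
  · obtain ⟨B₁, hB₁, hxB₁, -⟩ := hdir x x hx hx
    refine connected_of_forall_exists_le (((h B₁ hB₁).2.2 x hxB₁).nonempty.mono
      (SimpleGraph.Subgraph.deleteVerts_mono (le_sSup hB₁)).1) fun a ha b hb => ?_
    obtain ⟨B₂, hB₂, haB₂, hbB₂⟩ := hdir a b ha.1 hb.1
    obtain ⟨B, hB, h₁, h₂⟩ := hF.directedOn B₁ hB₁ B₂ hB₂
    exact ⟨B.deleteVerts {x}, SimpleGraph.Subgraph.deleteVerts_mono (le_sSup hB),
      (h B hB).2.2 x (h₁.1 hxB₁), ⟨h₂.1 haB₂, ha.2⟩, ⟨h₂.1 hbB₂, hb.2⟩⟩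

lemma IsTwoConnected.exists_le_maximal {B : G.Subgraph} (hB : IsTwoConnected B) :
    ∃ M, B ≤ M ∧ Maximal IsTwoConnected M :=
  zorn_le_nonempty₀ {B : G.Subgraph | IsTwoConnected B} (fun F hF hchain A hA =>
    ⟨sSup F, isTwoConnected_sSup hchain ⟨A, hA⟩ hF, fun _ => le_sSup⟩) B hB

lemma connected_deleteVerts_toSubgraph {x : V} {p : G.Walk x x} (hp : p.IsCycle) :
    (p.toSubgraph.deleteVerts {x}).Connected := by
  cases p with
  | nil => exact absurd rfl hp.ne_nil
  | @cons _ y _ h q =>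
    have hq : q.IsPath := ((SimpleGraph.Walk.cons_isCycle_iff q h).1 hp).1
    have hnil : ¬ q.Nil := fun hn => h.ne hn.eq.symm
    have hconcat := q.concat_dropLast (q.adj_penultimate hnil)
    have hsupp : q.support = q.dropLast.support ++ [x] :=
      (congrArg SimpleGraph.Walk.support hconcat).symm.trans (SimpleGraph.Walk.support_concat _ _)
    have hx : x ∉ q.dropLast.support := fun hxs => by
      have hnodup := hq.support_nodup
      rw [hsupp, List.nodup_append] at hnodup
      exact hnodup.2.2 x hxs x (List.mem_singleton_self x) rfl
    have hle : q.dropLast.toSubgraph ≤ (SimpleGraph.Walk.cons h q).toSubgraph := by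
      have hsup := congrArg SimpleGraph.Walk.toSubgraph hconcat
      rw [SimpleGraph.Walk.concat_eq_append, SimpleGraph.Walk.toSubgraph_append] at hsup
      exact le_sup_left.trans (hsup.le.trans le_sup_right)
    have hverts : q.dropLast.toSubgraph.verts =
        ((SimpleGraph.Walk.cons h q).toSubgraph.deleteVerts {x}).verts := by
      ext z
      simp only [SimpleGraph.Walk.mem_verts_toSubgraph, SimpleGraph.Subgraph.deleteVerts_verts,
        Set.mem_sdiff, SimpleGraph.Walk.support_cons, Set.mem_singleton_iff, hsupp]
      grind
    refine q.dropLast.toSubgraph_connected.mono' (fun a b hab => ?_) hverts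
    have ha := hverts.le (q.dropLast.toSubgraph.edge_vert hab)
    have hb := hverts.le (q.dropLast.toSubgraph.edge_vert hab.symm)
    exact SimpleGraph.Subgraph.deleteVerts_adj.2 ⟨ha.1, ha.2, hb.1, hb.2, hle.2 hab⟩

lemma isTwoConnected_toSubgraph {u : V} {p : G.Walk u u} (hp : p.IsCycle) :
    IsTwoConnected p.toSubgraph := by
  classical
  refine ⟨?_, p.toSubgraph_connected, fun x hx => ?_⟩
  · have hsub : (p.support.dropLast.toFinset : Set V) ⊆ p.toSubgraph.verts := fun x hx => by
      rw [SimpleGraph.Walk.mem_verts_toSubgraph]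
      exact List.mem_of_mem_dropLast (List.mem_toFinset.1 hx)
    refine le_trans ?_ (Set.encard_le_encard hsub)
    rw [Set.encard_coe_eq_coe_finsetCard, List.toFinset_card_of_nodup hp.nodup_dropLast_support,
      List.length_dropLast, SimpleGraph.Walk.length_support]
    exact_mod_cast hp.three_le_length
  · rw [SimpleGraph.Walk.mem_verts_toSubgraph] at hx
    rw [← p.toSubgraph_rotate hx]
    exact connected_deleteVerts_toSubgraph (hp.rotate hx)

lemma exists_isBlock_adj {x y : V} (h : G.Adj x y) : ∃ B : G.Subgraph, IsBlock G B ∧ B.Adj x y := by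
  by_cases hb : G.IsBridge s(x, y)
  · exact ⟨G.subgraphOfAdj h, Or.inl ⟨x, y, h, hb, rfl⟩, rfl⟩
  · rw [SimpleGraph.isBridge_iff_forall_cycle_notMem (G.mem_edgeSet.2 h)] at hb
    push Not at hb
    obtain ⟨u, p, hp, he⟩ := hb
    obtain ⟨B, hle, hB⟩ := (isTwoConnected_toSubgraph hp).exists_le_maximal
    exact ⟨B, Or.inr hB, hle.2 (SimpleGraph.Walk.adj_toSubgraph_iff_mem_edges.2 he)⟩

lemma IsBlock.reachable_compl {B : G.Subgraph} (hB : IsBlock G B) {c : V}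
    {x y : ({c}ᶜ : Set V)} (hx : B.Adj c x) (hy : B.Adj c y) :
    (G.induce ({c}ᶜ : Set V)).Reachable x y := by
  rcases hB with ⟨u, v, huv, -, rfl⟩ | hB
  · rw [SimpleGraph.subgraphOfAdj_adj] at hx hy
    rw [Subtype.ext (Sym2.congr_right.1 (hx.symm.trans hy))]
  · have hconn := hB.prop.connected_induce_sdiff c
    exact (hconn.preconnected ⟨x, B.edge_vert hx.symm, x.2⟩ ⟨y, B.edge_vert hy.symm, y.2⟩).map
      (G.induceHomOfLE fun _ hz => hz.2).toHom

lemma exists_adj_reachable_compl (hG : G.Connected) {c : V} (a : ({c}ᶜ : Set V)) :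
    ∃ x : ({c}ᶜ : Set V), G.Adj c x ∧ (G.induce ({c}ᶜ : Set V)).Reachable a x := by
  obtain ⟨p⟩ := hG.preconnected a c
  obtain ⟨d, -, ⟨hd, had⟩, hsnd⟩ := p.exists_boundary_dart
    {v | ∃ h : v ∈ ({c}ᶜ : Set V), (G.induce ({c}ᶜ : Set V)).Reachable a ⟨v, h⟩}
    ⟨a.2, SimpleGraph.Reachable.refl _⟩ (fun ⟨h, _⟩ => h rfl)
  have hdc : d.snd = c := by
    by_contra hne
    have hadj : (G.induce ({c}ᶜ : Set V)).Adj ⟨d.fst, hd⟩ ⟨d.snd, hne⟩ := d.adj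
    exact hsnd ⟨hne, had.trans hadj.reachable⟩
  exact ⟨⟨d.fst, hd⟩, hdc ▸ d.adj.symm, had⟩

lemma IsCutVertex.exists_two_blocks (hG : G.Connected) {c : V} (hc : IsCutVertex G c) :
    ∃ B₁ B₂ : G.Subgraph, IsBlock G B₁ ∧ IsBlock G B₂ ∧ B₁ ≠ B₂ ∧
      c ∈ B₁.verts ∧ c ∈ B₂.verts := by
  obtain ⟨a, b, -, hab⟩ := hc
  obtain ⟨x, hx, hax⟩ := exists_adj_reachable_compl hG a
  obtain ⟨y, hy, hby⟩ := exists_adj_reachable_compl hG b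
  obtain ⟨B₁, hB₁, h1⟩ := exists_isBlock_adj hx
  obtain ⟨B₂, hB₂, h2⟩ := exists_isBlock_adj hy
  refine ⟨B₁, B₂, hB₁, hB₂, ?_, B₁.edge_vert h1, B₂.edge_vert h2⟩
  rintro rfl
  exact hab (hax.trans ((hB₁.reachable_compl h1 h2).trans hby.symm))

end TwoConnected

/-! ### Disjoint families of sets -/

section DisjointFamily

variable {α W : Type*} {B : W → Set α} {S : Set α}

/-- The indices of the members of the family `B` that meet `S`. -/
def meets (B : W → Set α) (S : Set α) : Set W := {w | (B w ∩ S).Nonempty}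

/-- Every element of `S` is the only element of `S` in some member of the family `B`. For disjoint
families this says that `B` covers `S` and that no member contains two elements of `S`. -/
def Splits (B : W → Set α) (S : Set α) : Prop := ∀ v ∈ S, ∃ w, B w ∩ S = {v}

lemma mem_meets {w : W} {v : α} (hw : v ∈ B w) (hv : v ∈ S) : w ∈ meets B S := ⟨v, hw, hv⟩

lemma Splits.exists_mem (h : Splits B S) {v : α} (hv : v ∈ S) : ∃ w, v ∈ B w :=
  (h v hv).imp fun _ hw => (hw.ge rfl).1

lemma eq_of_mem_of_mem (hB : Pairwise (Function.onFun Disjoint B)) {w w' : W} {v : α}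
    (hw : v ∈ B w) (hw' : v ∈ B w') : w = w' :=
  hB.eq (Set.not_disjoint_iff.2 ⟨v, hw, hw'⟩)

lemma Splits.eq_of_mem (hB : Pairwise (Function.onFun Disjoint B)) (h : Splits B S) {w : W}
    {u v : α} (hu : u ∈ S) (hv : v ∈ S) (huw : u ∈ B w) (hvw : v ∈ B w) : u = v := by
  obtain ⟨w', hw'⟩ := h v hv
  obtain rfl := eq_of_mem_of_mem hB hvw (hw'.ge rfl).1
  exact hw'.le ⟨huw, hu⟩

lemma Splits.card_le [Finite W] (h : Splits B Set.univ) : Nat.card α ≤ Nat.card W := by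
  choose f hf using fun v => h v (Set.mem_univ v)
  refine Nat.card_le_card_of_injective f fun u v huv => ?_
  rw [← Set.singleton_eq_singleton_iff, ← hf, ← hf, huv]

lemma exists_injective_representatives (hB : Pairwise (Function.onFun Disjoint B)) (S : Set α) :
    ∃ g : meets B S → α, Function.Injective g ∧ ∀ w, g w ∈ B w.1 ∩ S := by
  choose g hg using fun w : meets B S => w.2
  exact ⟨g, fun w w' h => Subtype.ext (eq_of_mem_of_mem hB (hg w).1 (h ▸ (hg w').1)), hg⟩

lemma ncard_meets_le (hB : Pairwise (Function.onFun Disjoint B)) (hS : S.Finite) :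
    (meets B S).ncard ≤ S.ncard := by
  obtain ⟨g, hg, hgS⟩ := exists_injective_representatives hB S
  have := hS.to_subtype
  exact Nat.card_le_card_of_injective (fun w => (⟨g w, (hgS w).2⟩ : S))
    fun w w' h => hg (congrArg Subtype.val h)

/-- Fix a representative in each member that meets `S`. An element that is not alone in its member
is either not a representative, or it is the representative of a member containing an element that
is not. -/
lemma ncard_not_alone_le (hB : Pairwise (Function.onFun Disjoint B)) (hS : S.Finite) :
    {v ∈ S | ∀ w, B w ∩ S ≠ {v}}.ncard ≤ 2 * (S.ncard - (meets B S).ncard) := by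
  obtain ⟨g, hg, hgS⟩ := exists_injective_representatives hB S
  have hRS : Set.range g ⊆ S := Set.range_subset_iff.2 fun w => (hgS w).2
  have hR : (Set.range g).ncard = (meets B S).ncard := Set.ncard_range_of_injective hg
  have hfin : (meets B S).Finite :=
    Set.finite_coe_iff.1 (Set.finite_range_iff hg |>.1 (hS.subset hRS))
  set D : Set α := S \ Set.range g with hD
  have hDcard : D.ncard = S.ncard - (meets B S).ncard := by
    rw [hD, Set.ncard_sdiff hRS (hS.subset hRS), hR]
  have hsub : {v ∈ S | ∀ w, B w ∩ S ≠ {v}} ⊆ D ∪ g '' {w | ↑w ∈ meets B D} := by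
    rintro v ⟨hv, hvB⟩
    by_cases hvR : v ∈ Set.range g
    · obtain ⟨w, rfl⟩ := hvR
      obtain ⟨u, hu, hne⟩ : ∃ u ∈ B w ∩ S, u ≠ g w := by
        by_contra! h
        exact hvB w (Set.eq_singleton_iff_unique_mem.2 ⟨hgS w, h⟩)
      refine Or.inr ⟨w, mem_meets hu.1 ⟨hu.2, ?_⟩, rfl⟩
      rintro ⟨w', rfl⟩
      exact hne (congrArg g (Subtype.ext (eq_of_mem_of_mem hB (hgS w').1 hu.1)))
    · exact Or.inl ⟨hv, hvR⟩
  have himage : (g '' {w | ↑w ∈ meets B D}).ncard ≤ D.ncard := by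
    have hDfin : D.Finite := hS.subset Set.sdiff_subset
    rw [Set.ncard_image_of_injective _ hg, ← Set.ncard_image_of_injective _ Subtype.val_injective]
    refine (Set.ncard_le_ncard ?_ (hfin.subset ?_)).trans (ncard_meets_le hB hDfin)
    · exact Set.image_subset_iff.2 fun _ h => h
    · exact fun w hw => hw.mono (Set.inter_subset_inter_right _ Set.sdiff_subset)
  have hfinal := Set.ncard_le_ncard hsub
    ((hS.subset Set.sdiff_subset).union (hS.subset ((Set.image_subset_range _ _).trans hRS)))
  have := Set.ncard_union_le D (g '' {w | ↑w ∈ meets B D})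
  omega

lemma splits_of_ncard_le (hB : Pairwise (Function.onFun Disjoint B)) (hS : S.Finite)
    (h : S.ncard ≤ (meets B S).ncard) : Splits B S := by
  have h0 := ncard_not_alone_le hB hS
  rw [Nat.sub_eq_zero_of_le h, mul_zero, Nat.le_zero, Set.ncard_eq_zero (hS.sep _)] at h0
  intro v hv
  by_contra! hno
  exact h0.le ⟨hv, hno⟩

end DisjointFamily

/-! ### Minors -/

section Minor

variable {U V W : Type*} {F : SimpleGraph U} {H : SimpleGraph W} {G : SimpleGraph V}

/-- The sets `B w` are the branch sets of a minor `H` of `G`. -/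
structure IsMinorModel (H : SimpleGraph W) (G : SimpleGraph V) (B : W → Set V) : Prop where
  connected : ∀ w, (G.induce (B w)).Connected
  disjoint : Pairwise (Function.onFun Disjoint B)
  exists_adj : ∀ ⦃w w'⦄, H.Adj w w' → ∃ x ∈ B w, ∃ y ∈ B w', G.Adj x y

lemma isMinor_iff_exists_isMinorModel : IsMinor H G ↔ ∃ B, IsMinorModel H G B :=
  ⟨fun ⟨B, h₁, h₂, h₃⟩ => ⟨B, h₁, h₂, h₃⟩, fun ⟨B, h₁, h₂, h₃⟩ => ⟨B, h₁, h₂, h₃⟩⟩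

lemma IsMinorModel.nonempty {B : W → Set V} (hB : IsMinorModel H G B) (w : W) : (B w).Nonempty :=
  Set.nonempty_coe_sort.1 (hB.connected w).nonempty

lemma connected_induce_biUnion {B : W → Set V} {A : Set W} (hA : (H.induce A).Connected)
    (hB : ∀ w ∈ A, (G.induce (B w)).Connected)
    (hadj : ∀ w ∈ A, ∀ w' ∈ A, H.Adj w w' → ∃ x ∈ B w, ∃ y ∈ B w', G.Adj x y) :
    (G.induce (⋃ w ∈ A, B w)).Connected := by
  rw [connected_induce_iff_boundary]
  refine ⟨?_, ?_⟩
  · obtain ⟨w, hw⟩ := (connected_induce_iff_boundary.1 hA).1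
    obtain ⟨x, hx⟩ := (connected_induce_iff_boundary.1 (hB w hw)).1
    exact ⟨x, Set.mem_biUnion hw hx⟩
  · rintro Z ⟨x, hx, hxZ⟩ ⟨y, hy, hyZ⟩
    obtain ⟨w, hw, hxw⟩ := Set.mem_iUnion₂.1 hx
    obtain ⟨w', hw', hyw⟩ := Set.mem_iUnion₂.1 hy
    by_cases hall : ∀ t ∈ A, B t ⊆ Z ∨ Disjoint (B t) Z
    · obtain ⟨s, hs, t, ht, hst, hsZ, htZ⟩ := exists_adj_boundary hA (A := {t | B t ⊆ Z}) hw
        ((hall w hw).resolve_right fun hd => Set.disjoint_left.1 hd hxw hxZ) hw'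
        (fun hsub => hyZ (hsub hyw))
      obtain ⟨a, ha, b, hb, hab⟩ := hadj s hs t ht hst
      exact ⟨a, Set.mem_biUnion hs ha, b, Set.mem_biUnion ht hb, hab, hsZ ha,
        Set.disjoint_left.1 ((hall t ht).resolve_left htZ) hb⟩
    · push Not at hall
      obtain ⟨t, ht, hn, hnd⟩ := hall
      obtain ⟨b, hb, hbZ⟩ := Set.not_subset.1 hn
      obtain ⟨a, ha, haZ⟩ := Set.not_disjoint_iff.1 hnd
      obtain ⟨p, hp, q, hq, hpq⟩ := exists_adj_boundary (hB t ht) ha haZ hb hbZ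
      exact ⟨p, Set.mem_biUnion ht hp, q, Set.mem_biUnion ht hq, hpq⟩

lemma IsMinor.trans (h : IsMinor F H) (h' : IsMinor H G) : IsMinor F G := by
  obtain ⟨A, hA⟩ := isMinor_iff_exists_isMinorModel.1 h
  obtain ⟨B, hB⟩ := isMinor_iff_exists_isMinorModel.1 h'
  refine isMinor_iff_exists_isMinorModel.2 ⟨fun u => ⋃ w ∈ A u, B w, fun u => ?_,
    fun u u' hne => ?_, fun u u' huu' => ?_⟩
  · exact connected_induce_biUnion (hA.connected u) (fun w _ => hB.connected w)
      fun w _ w' _ hadj => hB.exists_adj hadj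
  · rw [Function.onFun, Set.disjoint_left]
    intro x hx hx'
    obtain ⟨w, hw, hxw⟩ := Set.mem_iUnion₂.1 hx
    obtain ⟨w', hw', hxw'⟩ := Set.mem_iUnion₂.1 hx'
    obtain rfl := eq_of_mem_of_mem hB.disjoint hxw hxw'
    exact hne (eq_of_mem_of_mem hA.disjoint hw hw')
  · obtain ⟨w, hw, w', hw', hadj⟩ := hA.exists_adj huu'
    obtain ⟨x, hx, y, hy, hxy⟩ := hB.exists_adj hadj
    exact ⟨x, Set.mem_biUnion hw hx, y, Set.mem_biUnion hw' hy, hxy⟩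

lemma isMinor_self (G : SimpleGraph V) : IsMinor G G := by
  refine isMinor_iff_exists_isMinorModel.2 ⟨fun v => {v}, fun v => ?_, fun v w h => ?_,
    fun v w h => ⟨v, rfl, w, rfl, h⟩⟩
  · rw [connected_induce_iff_boundary]
    refine ⟨⟨v, rfl⟩, ?_⟩
    rintro A ⟨x, rfl, hx⟩ ⟨y, rfl, hy⟩
    exact absurd hx hy
  · simpa [Function.onFun] using h

lemma IsMinorModel.meets_univ {B : W → Set V} (hB : IsMinorModel H G B) :
    meets B Set.univ = Set.univ :=
  Set.eq_univ_of_forall fun w => (hB.nonempty w).imp fun _ hx => ⟨hx, trivial⟩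

lemma IsMinor.card_le [Finite V] (h : IsMinor H G) : Nat.card W ≤ Nat.card V := by
  obtain ⟨B, hB⟩ := isMinor_iff_exists_isMinorModel.1 h
  rw [← Set.ncard_univ, ← hB.meets_univ, ← Set.ncard_univ]
  exact ncard_meets_le hB.disjoint Set.finite_univ

lemma IsMinor.exists_bijective_hom [Finite V] [Finite W] (h : IsMinor H G)
    (hc : Nat.card V ≤ Nat.card W) : ∃ f : H →g G, Function.Bijective f := by
  obtain ⟨B, hB⟩ := isMinor_iff_exists_isMinorModel.1 h
  have hsplit : Splits B Set.univ := by
    refine splits_of_ncard_le hB.disjoint Set.finite_univ ?_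
    rwa [hB.meets_univ, Set.ncard_univ, Set.ncard_univ]
  choose f hf using hB.nonempty
  have huniq {v w} (hv : v ∈ B w) : v = f w :=
    hsplit.eq_of_mem hB.disjoint trivial trivial hv (hf w)
  have hinj : Function.Injective f := fun w w' hww =>
    eq_of_mem_of_mem hB.disjoint (hf w) (hww ▸ hf w')
  refine ⟨⟨f, fun {w w'} hadj => ?_⟩, hinj.bijective_of_nat_card_le hc⟩
  obtain ⟨x, hx, y, hy, hxy⟩ := hB.exists_adj hadj
  rwa [huniq hx, huniq hy] at hxy

lemma nonempty_iso_of_bijective_hom [Fintype V] [Fintype W] [DecidableRel H.Adj]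
    [DecidableRel G.Adj] (f : H →g G) (hf : Function.Bijective f)
    (hdeg : ∀ w, G.degree (f w) ≤ H.degree w) : Nonempty (H ≃g G) := by
  refine ⟨⟨Equiv.ofBijective f hf, fun {w w'} => ⟨fun hadj => ?_, f.map_rel⟩⟩⟩
  have hbij : Function.Bijective ((f.toCopy hf.1).mapNeighborSet w) := by
    refine ((f.toCopy hf.1).mapNeighborSet w).injective.bijective_of_nat_card_le ?_
    rw [Nat.card_eq_fintype_card, Nat.card_eq_fintype_card, SimpleGraph.card_neighborSet_eq_degree,
      SimpleGraph.card_neighborSet_eq_degree]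
    exact hdeg w
  obtain ⟨⟨u, hu⟩, huw⟩ := hbij.2 ⟨f w', hadj⟩
  rwa [← hf.1 (congrArg Subtype.val huw)]

end Minor

lemma memDHat_of_card_le {V : Type u} [Fintype V] [Nonempty V] {G : SimpleGraph V}
    [DecidableRel G.Adj] {k : ℕ} (hG : G.IsRegularOfDegree (k + 1))
    (h : ∀ (W : Type u) [Fintype W] (H : SimpleGraph W) [DecidableRel H.Adj],
      IsMinor H G → k < H.minDegree → Nat.card V ≤ Nat.card W) : MemDHat k G := by
  classical
  refine ⟨fun hD => ?_, fun W _ H hH W' _ H' _ hH' => ?_⟩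
  · exact absurd (hD V G (isMinor_self G)) (by simp [hG.minDegree_eq])
  · by_contra! hk
    have hcard := h W' H' (hH'.trans hH.1) hk
    obtain ⟨f, hf⟩ := hH'.exists_bijective_hom (hH.1.card_le.trans hcard)
    obtain ⟨g, hg⟩ := hH.1.exists_bijective_hom (hcard.trans hH'.card_le)
    have hHk : k < H.minDegree :=
      hk.trans_le (SimpleGraph.Copy.minDegree_mono (f := f.toCopy hf.1) hf.2)
    exact not_nonempty_iff.2 hH.2 (nonempty_iso_of_bijective_hom g hg fun w =>
      (hG.degree_eq _).trans_le (hHk.trans_le (H.minDegree_le_degree w)))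

/-! ### The construction -/

section Construction

variable {I C : Type*}

/-- `T` is a tree with at least one edge, bipartite between `I` (the blocks) and `C` (the
cut-vertices), all of whose leaves are in `I`. These are the properties of block decomposition
trees with an edge that the construction needs. -/
structure IsBlockCutTree (T : SimpleGraph (I ⊕ C)) : Prop where
  isTree : T.IsTree
  not_adj_inl : ∀ b b' : I, ¬ T.Adj (Sum.inl b) (Sum.inl b')
  not_adj_inr : ∀ c c' : C, ¬ T.Adj (Sum.inr c) (Sum.inr c')
  exists_two : ∀ c, ∃ b b', b ≠ b' ∧ T.Adj (Sum.inl b) (Sum.inr c) ∧ T.Adj (Sum.inl b') (Sum.inr c)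
  nonempty_cut : Nonempty C

variable (T : SimpleGraph (I ⊕ C))

/-- The vertices of the block `b` that are not cut-vertices. For each cut-vertex `c` of `b` there
are `6 * s - 5` vertices that will not be joined to `c`, where `s ≥ 1` is the size of the side of
`c` of the edge `bc`; this leaves `c` with degree `6 * (|T| - s)` in the block. The remaining
vertices come in pairs that will not be joined to each other; their number makes up for the
subtracted `5`, and there are at least three pairs. -/
abbrev Inner (b : I) : Type _ :=
  (Σ c : {c : C // T.Adj (Sum.inl b) (Sum.inr c)},
      Fin (6 * (side T (Sum.inr c.1) (Sum.inl b)).ncard - 5)) ⊕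
    (Fin (2 * Nat.card {c : C // T.Adj (Sum.inl b) (Sum.inr c)} + 1) × Bool)

/-- The vertices of the graph with block decomposition tree `T`. -/
abbrev Vertex : Type _ := C ⊕ Σ b : I, Inner T b

variable {T}

/-- The only vertex of its block that an inner vertex is not joined to. A cut-vertex is its own
mate. -/
def mate : Vertex T → Vertex T
  | Sum.inl c => Sum.inl c
  | Sum.inr ⟨_, Sum.inl ⟨c, _⟩⟩ => Sum.inl c.1
  | Sum.inr ⟨b, Sum.inr (i, t)⟩ => Sum.inr ⟨b, Sum.inr (i, !t)⟩

/-- The vertex of `T` that stands for a vertex of the graph: a cut-vertex stands for itself, and an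
inner vertex of a block for that block. -/
def proj : Vertex T → I ⊕ C
  | Sum.inl c => Sum.inr c
  | Sum.inr p => Sum.inl p.1

variable (T) in
/-- The vertices of the block `b`. -/
def blockSet (b : I) : Set (Vertex T) := {v | proj v = Sum.inl b ∨ T.Adj (Sum.inl b) (proj v)}

variable (T) in
/-- The graph with block decomposition tree `T`: two vertices of a block are joined unless one is
the mate of the other. -/
def glued : SimpleGraph (Vertex T) where
  Adj u v := (∃ b, u ∈ blockSet T b ∧ v ∈ blockSet T b) ∧ u ≠ v ∧ v ≠ mate u ∧ u ≠ mate v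
  symm := ⟨fun _ _ ⟨⟨b, h1, h2⟩, h3, h4, h5⟩ => ⟨⟨b, h2, h1⟩, h3.symm, h5, h4⟩⟩
  loopless := ⟨fun _ h => h.2.1 rfl⟩

lemma inl_mem_blockSet {b : I} {c : C} :
    (Sum.inl c : Vertex T) ∈ blockSet T b ↔ T.Adj (Sum.inl b) (Sum.inr c) := by
  simp [blockSet, proj]

lemma proj_eq_inr {v : Vertex T} {c : C} : proj v = Sum.inr c ↔ v = Sum.inl c := by
  cases v <;> simp [proj]

lemma mate_inr_ne (p : Σ b : I, Inner T b) : mate (Sum.inr p) ≠ Sum.inr p := by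
  obtain ⟨b, ⟨c, i⟩ | ⟨i, t⟩⟩ := p <;> simp [mate]

lemma mate_eq_of_mate_eq_inr {v : Vertex T} {p : Σ b : I, Inner T b}
    (h : mate v = Sum.inr p) : mate (Sum.inr p) = v := by
  obtain c | ⟨b, ⟨c, i⟩ | ⟨i, t⟩⟩ := v
  · simp [mate] at h
  · simp [mate] at h
  · simp [← h, mate]

namespace IsBlockCutTree

variable (hT : IsBlockCutTree T)
include hT

lemma inr_mem_blockSet {b : I} {p : Σ b : I, Inner T b} :
    (Sum.inr p : Vertex T) ∈ blockSet T b ↔ p.1 = b := by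
  simp [blockSet, proj, hT.not_adj_inl]

lemma mate_mem_blockSet (p : Σ b : I, Inner T b) : mate (Sum.inr p) ∈ blockSet T p.1 := by
  obtain ⟨b, ⟨c, i⟩ | ⟨i, t⟩⟩ := p
  · exact inl_mem_blockSet.2 c.2
  · exact hT.inr_mem_blockSet.2 rfl

lemma exists_mem_blockSet (v : Vertex T) : ∃ b, v ∈ blockSet T b := by
  cases v with
  | inl c =>
    obtain ⟨b, -, -, h, -⟩ := hT.exists_two c
    exact ⟨b, inl_mem_blockSet.2 h⟩
  | inr p => exact ⟨p.1, hT.inr_mem_blockSet.2 rfl⟩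

lemma adj_inr {p : Σ b : I, Inner T b} {v : Vertex T} :
    (glued T).Adj (Sum.inr p) v ↔
      v ∈ blockSet T p.1 ∧ v ≠ Sum.inr p ∧ v ≠ mate (Sum.inr p) := by
  constructor
  · rintro ⟨⟨b, h1, h2⟩, h3, h4, -⟩
    obtain rfl := hT.inr_mem_blockSet.1 h1
    exact ⟨h2, h3.symm, h4⟩
  · rintro ⟨h1, h2, h3⟩
    exact ⟨⟨p.1, hT.inr_mem_blockSet.2 rfl, h1⟩, h2.symm, h3,
      fun h => h3 (mate_eq_of_mate_eq_inr h.symm).symm⟩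

lemma mem_side_of_mem_blockSet {b : I} {c : C} (h : T.Adj (Sum.inl b) (Sum.inr c))
    {v : Vertex T} (hv : v ∈ blockSet T b) (hvc : v ≠ Sum.inl c) :
    proj v ∈ side T (Sum.inl b) (Sum.inr c) := by
  rcases hv with hv | hv
  · rw [hv]
    exact self_mem_side h
  · refine (mem_side_or_mem_side hT.isTree h _).resolve_right fun hs => hvc (proj_eq_inr.1 ?_)
    exact (BlockStructure.eq_of_adj_of_mem_side hT.isTree h hv (self_mem_side h) hs).2

lemma notMem_side_of_mem_blockSet {b b' : I} {c : C} (hb : b ≠ b')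
    (h : T.Adj (Sum.inl b) (Sum.inr c)) (h' : T.Adj (Sum.inl b') (Sum.inr c))
    {v : Vertex T} (hv : v ∈ blockSet T b') : proj v ∉ side T (Sum.inl b) (Sum.inr c) := by
  intro hs
  by_cases hvc : v = Sum.inl c
  · subst hvc
    exact self_notMem_side _ _ hs
  · exact hb (Sum.inl_injective (eq_of_mem_side hT.isTree h.symm h'.symm hs
      (hT.mem_side_of_mem_blockSet h' hv hvc)))

lemma block_eq_of_mem {b b' : I} {u v : Vertex T} (huv : u ≠ v)
    (hu : u ∈ blockSet T b) (hv : v ∈ blockSet T b) (hu' : u ∈ blockSet T b')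
    (hv' : v ∈ blockSet T b') : b = b' := by
  cases u with
  | inr p => exact (hT.inr_mem_blockSet.1 hu).symm.trans (hT.inr_mem_blockSet.1 hu')
  | inl c =>
    by_contra hb
    rw [inl_mem_blockSet] at hu hu'
    exact hT.notMem_side_of_mem_blockSet hb hu hu' hv' (hT.mem_side_of_mem_blockSet hu hv huv.symm)

lemma eq_of_mem_blockSet_of_mem_side {b b' : I} {c : C} (h : T.Adj (Sum.inl b) (Sum.inr c))
    {u v : Vertex T} (hub : u ∈ blockSet T b') (hvb : v ∈ blockSet T b')
    (hu : proj u ∈ side T (Sum.inl b) (Sum.inr c))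
    (hv : proj v ∉ side T (Sum.inl b) (Sum.inr c)) : b' = b := by
  have hv' := (mem_side_or_mem_side hT.isTree h (proj v)).resolve_left hv
  by_contra hb
  rcases mem_side_or_mem_side hT.isTree h (Sum.inl b') with hs | hs
  · rcases hvb with hvb | hvb
    · exact hv (hvb ▸ hs)
    · exact hb (Sum.inl_injective (eq_of_adj_of_mem_side hT.isTree h hvb hs hv').1)
  · rcases hub with hub | hub
    · exact notMem_side hs (hub ▸ hu)
    · exact Sum.inl_ne_inr (eq_of_adj_of_mem_side hT.isTree h hub.symm hu hs).2

lemma eq_inl_of_adj_of_mem_side {b : I} {c : C} (h : T.Adj (Sum.inl b) (Sum.inr c))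
    {u v : Vertex T} (huv : (glued T).Adj u v) (hu : proj u ∈ side T (Sum.inl b) (Sum.inr c))
    (hv : proj v ∉ side T (Sum.inl b) (Sum.inr c)) : v = Sum.inl c ∧ u ∈ blockSet T b := by
  obtain ⟨⟨b', hub, hvb⟩, -⟩ := huv
  obtain rfl := hT.eq_of_mem_blockSet_of_mem_side h hub hvb hu hv
  exact ⟨by_contra fun hne => hv (hT.mem_side_of_mem_blockSet h hvb hne), hub⟩

lemma exists_adj_inl (b : I) : ∃ c, T.Adj (Sum.inl b) (Sum.inr c) := by
  obtain ⟨c⟩ := hT.nonempty_cut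
  obtain ⟨u, hu, -⟩ :=
    exists_adj_mem_side hT.isTree (x := Sum.inr c) (v := Sum.inl b) Sum.inr_ne_inl
  cases u with
  | inl b' => exact absurd hu (hT.not_adj_inl _ _)
  | inr c' => exact ⟨c', hu⟩

/-- The inner vertices and the cut-vertices of a block make up the block. -/
def blockEquiv (b : I) :
    {c : C // T.Adj (Sum.inl b) (Sum.inr c)} ⊕ Inner T b ≃ blockSet T b where
  toFun
    | Sum.inl c => ⟨Sum.inl c.1, inl_mem_blockSet.2 c.2⟩
    | Sum.inr p => ⟨Sum.inr ⟨b, p⟩, hT.inr_mem_blockSet.2 rfl⟩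
  invFun
    | ⟨Sum.inl c, h⟩ => Sum.inl ⟨c, inl_mem_blockSet.1 h⟩
    | ⟨Sum.inr p, h⟩ => Sum.inr (hT.inr_mem_blockSet.1 h ▸ p.2)
  left_inv := by rintro (c | p) <;> rfl
  right_inv := by
    rintro ⟨c | ⟨b', p⟩, h⟩
    · rfl
    · obtain rfl := hT.inr_mem_blockSet.1 h
      rfl

end IsBlockCutTree

end Construction

/-! ### Degrees -/

section Degrees

variable {I C : Type*} [Finite I] [Finite C] {T : SimpleGraph (I ⊕ C)}

lemma ncard_side_pos {V : Type*} [Finite V] {T : SimpleGraph V} {u v : V} (h : T.Adj u v) :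
    0 < (side T u v).ncard :=
  (Set.ncard_pos (Set.toFinite _)).2 ⟨_, self_mem_side h⟩

namespace IsBlockCutTree

variable (hT : IsBlockCutTree T)
include hT

lemma ncard_edgeSet_add_one : T.edgeSet.ncard + 1 = Nat.card (I ⊕ C) :=
  (SimpleGraph.isTree_iff_connected_and_card.1 hT.isTree).2

lemma sum_ncard_side_inr (b : I) [Fintype {c : C // T.Adj (Sum.inl b) (Sum.inr c)}] :
    ∑ c : {c : C // T.Adj (Sum.inl b) (Sum.inr c)}, (side T (Sum.inr c.1) (Sum.inl b)).ncard =
      T.edgeSet.ncard := by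
  refine Nat.add_right_cancel ((sum_ncard_side_add_one hT.isTree (Sum.inl b)
    (Sum.inr_injective.comp Subtype.val_injective) ?_).trans hT.ncard_edgeSet_add_one.symm)
  ext (b' | c)
  · simp [hT.not_adj_inl]
  · simp

lemma sum_ncard_side_inl (c : C) [Fintype {b : I // T.Adj (Sum.inl b) (Sum.inr c)}] :
    ∑ b : {b : I // T.Adj (Sum.inl b) (Sum.inr c)}, (side T (Sum.inl b.1) (Sum.inr c)).ncard =
      T.edgeSet.ncard := by
  refine Nat.add_right_cancel ((sum_ncard_side_add_one hT.isTree (Sum.inr c)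
    (Sum.inl_injective.comp Subtype.val_injective) ?_).trans hT.ncard_edgeSet_add_one.symm)
  ext (b | c')
  · simp [T.adj_comm (Sum.inr c)]
  · simp [hT.not_adj_inr]

lemma ncard_edgeSet_pos : 0 < T.edgeSet.ncard := by
  obtain ⟨c⟩ := hT.nonempty_cut
  obtain ⟨b, -, -, h, -⟩ := hT.exists_two c
  exact (Set.ncard_pos (Set.toFinite _)).2 ⟨_, T.mem_edgeSet.2 h⟩

lemma ncard_blockSet (b : I) : (blockSet T b).ncard = 6 * T.edgeSet.ncard + 2 := by
  have := Fintype.ofFinite {c : C // T.Adj (Sum.inl b) (Sum.inr c)}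
  have hmissing : ∑ c : {c : C // T.Adj (Sum.inl b) (Sum.inr c)},
      (6 * (side T (Sum.inr c.1) (Sum.inl b)).ncard - 5) +
      5 * Nat.card {c : C // T.Adj (Sum.inl b) (Sum.inr c)} = 6 * T.edgeSet.ncard := by
    rw [← hT.sum_ncard_side_inr b, Finset.mul_sum, Nat.card_eq_fintype_card, ← Finset.card_univ,
      mul_comm 5, ← smul_eq_mul (b := 5), ← Finset.sum_const, ← Finset.sum_add_distrib]
    refine Finset.sum_congr rfl fun c _ => ?_
    have := ncard_side_pos c.2.symm
    omega
  rw [← Nat.card_coe_set_eq, ← Nat.card_congr (hT.blockEquiv b), Nat.card_sum, Nat.card_sum,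
    Nat.card_sigma, Nat.card_prod, Nat.card_fin]
  simp only [Nat.card_fin, Nat.card_eq_fintype_card (α := Bool), Fintype.card_bool]
  omega

lemma ncard_neighborSet_inr (p : Σ b : I, Inner T b) :
    ((glued T).neighborSet (Sum.inr p)).ncard = 6 * T.edgeSet.ncard := by
  have h : (glued T).neighborSet (Sum.inr p) =
      blockSet T p.1 \ {Sum.inr p, mate (Sum.inr p)} := by
    ext v
    simp only [SimpleGraph.mem_neighborSet, hT.adj_inr, Set.mem_sdiff, Set.mem_insert_iff,
      Set.mem_singleton_iff, not_or]
  have hsub : {Sum.inr p, mate (Sum.inr p)} ⊆ blockSet T p.1 :=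
    Set.pair_subset (hT.inr_mem_blockSet.2 rfl) (hT.mate_mem_blockSet p)
  rw [h, Set.ncard_sdiff hsub, hT.ncard_blockSet, Set.ncard_pair (mate_inr_ne p).symm,
    Nat.add_sub_cancel]

lemma ncard_blockSet_inter_mate {b : I} {c : C} (h : T.Adj (Sum.inl b) (Sum.inr c)) :
    (blockSet T b ∩ mate ⁻¹' {Sum.inl c}).ncard =
      6 * (side T (Sum.inr c) (Sum.inl b)).ncard - 4 := by
  let missing (i : Fin (6 * (side T (Sum.inr c) (Sum.inl b)).ncard - 5)) : Vertex T :=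
    Sum.inr ⟨b, Sum.inl ⟨⟨c, h⟩, i⟩⟩
  have hinj : Function.Injective missing := fun i j hij => by simpa [missing] using hij
  have heq : blockSet T b ∩ mate ⁻¹' {Sum.inl c} = insert (Sum.inl c) (Set.range missing) := by
    ext v
    constructor
    · rintro ⟨hvb, hv⟩
      obtain c' | ⟨b', ⟨c', i⟩ | ⟨i, t⟩⟩ := v
      · exact Or.inl hv
      · obtain rfl : b' = b := hT.inr_mem_blockSet.1 hvb
        obtain rfl : c' = ⟨c, h⟩ := Subtype.ext (Sum.inl_injective hv)
        exact Or.inr ⟨i, rfl⟩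
      · exact absurd hv Sum.inr_ne_inl
    · rintro (rfl | ⟨i, rfl⟩)
      · exact ⟨inl_mem_blockSet.2 h, rfl⟩
      · exact ⟨hT.inr_mem_blockSet.2 rfl, rfl⟩
  have := ncard_side_pos h.symm
  rw [heq, Set.ncard_insert_of_notMem (by simp [missing]), Set.ncard_range_of_injective hinj,
    Nat.card_fin]
  omega

lemma ncard_neighborSet_inter {b : I} {c : C} (h : T.Adj (Sum.inl b) (Sum.inr c)) :
    ((glued T).neighborSet (Sum.inl c) ∩ blockSet T b).ncard =
      6 * (side T (Sum.inl b) (Sum.inr c)).ncard := by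
  have heq : (glued T).neighborSet (Sum.inl c) ∩ blockSet T b =
      blockSet T b \ (blockSet T b ∩ mate ⁻¹' {Sum.inl c}) := by
    ext v
    constructor
    · rintro ⟨⟨-, -, -, hm⟩, hvb⟩
      exact ⟨hvb, fun hv => hm hv.2.symm⟩
    · rintro ⟨hvb, hv⟩
      have hm : mate v ≠ Sum.inl c := fun hm => hv ⟨hvb, hm⟩
      have hvc : v ≠ Sum.inl c := by
        rintro rfl
        exact hm rfl
      exact ⟨⟨⟨b, inl_mem_blockSet.2 h, hvb⟩, hvc.symm, hvc, hm.symm⟩, hvb⟩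
  rw [heq, Set.ncard_sdiff Set.inter_subset_left, hT.ncard_blockSet, hT.ncard_blockSet_inter_mate h]
  have := ncard_side_pos h.symm
  have := ncard_side_add_ncard_side hT.isTree h
  have := hT.ncard_edgeSet_add_one
  omega

lemma ncard_neighborSet_inl (c : C) :
    ((glued T).neighborSet (Sum.inl c)).ncard = 6 * T.edgeSet.ncard := by
  have := Fintype.ofFinite {b : I // T.Adj (Sum.inl b) (Sum.inr c)}
  have hunion : (glued T).neighborSet (Sum.inl c) =
      ⋃ b : {b : I // T.Adj (Sum.inl b) (Sum.inr c)},
        (glued T).neighborSet (Sum.inl c) ∩ blockSet T b.1 := by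
    rw [← Set.inter_iUnion, eq_comm, Set.inter_eq_left]
    rintro v ⟨⟨b, hcb, hvb⟩, -⟩
    exact Set.mem_iUnion.2 ⟨⟨b, inl_mem_blockSet.1 hcb⟩, hvb⟩
  have hdisj : Pairwise (Function.onFun Disjoint
      fun b : {b : I // T.Adj (Sum.inl b) (Sum.inr c)} =>
        (glued T).neighborSet (Sum.inl c) ∩ blockSet T b.1) := fun b b' hbb' =>
    Set.disjoint_left.2 fun v ⟨hv, hvb⟩ ⟨_, hvb'⟩ => hbb' (Subtype.ext (hT.block_eq_of_mem
      ((glued T).ne_of_adj hv) (inl_mem_blockSet.2 b.2) hvb (inl_mem_blockSet.2 b'.2) hvb'))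
  rw [hunion, Set.ncard_iUnion_of_finite (fun _ => Set.toFinite _) hdisj,
    finsum_eq_sum_of_fintype, ← hT.sum_ncard_side_inl c, Finset.mul_sum]
  exact Finset.sum_congr rfl fun b _ => hT.ncard_neighborSet_inter b.2

lemma isRegularOfDegree_glued [Fintype (Vertex T)] [DecidableRel (glued T).Adj] :
    (glued T).IsRegularOfDegree (6 * T.edgeSet.ncard) := by
  intro v
  rw [← SimpleGraph.card_neighborSet_eq_degree, ← Nat.card_eq_fintype_card, Nat.card_coe_set_eq]
  cases v with
  | inl c => exact hT.ncard_neighborSet_inl c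
  | inr p => exact hT.ncard_neighborSet_inr p

end IsBlockCutTree

end Degrees

/-! ### Minimality -/

section Minimality

variable {I C W : Type*} {T : SimpleGraph (I ⊕ C)} {H : SimpleGraph W} {B : W → Set (Vertex T)}

/-- The blocks that the branch set of `w` cannot enter: the pairs of a cut-vertex in `B w` and a
block of this cut-vertex all of whose vertices are in distinct branch sets. -/
def flags (B : W → Set (Vertex T)) (w : W) : Set (C × I) :=
  {f | Sum.inl f.1 ∈ B w ∧ T.Adj (Sum.inl f.2) (Sum.inr f.1) ∧ Splits B (blockSet T f.2)}

/-- The part of the tree that the branch set of `w` cannot enter because of the blocks in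
`flags B w`. -/
def cutOff (B : W → Set (Vertex T)) (w : W) : Set (I ⊕ C) :=
  ⋃ f ∈ flags B w, side T (Sum.inl f.2) (Sum.inr f.1)

namespace IsBlockCutTree

lemma eq_singleton_of_inter_blockSet (hT : IsBlockCutTree T) {S : Set (Vertex T)}
    (hS : ((glued T).induce S).Connected) {p : Σ b : I, Inner T b}
    (h : S ∩ blockSet T p.1 = {Sum.inr p}) : S = {Sum.inr p} := by
  refine Set.eq_singleton_iff_unique_mem.2 ⟨(h.ge rfl).1, fun v hv => ?_⟩
  by_contra hne
  obtain ⟨u, -, z, hz, huz, rfl, hzp⟩ :=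
    exists_adj_boundary hS (h.ge rfl).1 (Set.mem_singleton (Sum.inr p)) hv hne
  exact hzp (h.le ⟨hz, (hT.adj_inr.1 huz).1⟩)

lemma subset_blockSet (hT : IsBlockCutTree T) {S : Set (Vertex T)}
    (hS : ((glued T).induce S).Connected) {b : I} {v : Vertex T} (hv : v ∈ S)
    (hvb : v ∈ blockSet T b) (h : ∀ c, T.Adj (Sum.inl b) (Sum.inr c) → Sum.inl c ∉ S) :
    S ⊆ blockSet T b := by
  intro y hy
  by_contra hyb
  obtain ⟨u, hu, z, -, huz, hub, hzb⟩ := exists_adj_boundary hS hv hvb hy hyb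
  cases u with
  | inl c => exact h c (inl_mem_blockSet.1 hub) hu
  | inr p =>
    obtain rfl := hT.inr_mem_blockSet.1 hub
    exact hzb (hT.adj_inr.1 huz).1

lemma mem_side_of_splits (hT : IsBlockCutTree T) (hB : IsMinorModel H (glued T) B) {b : I} {c : C}
    (h : T.Adj (Sum.inl b) (Sum.inr c)) (hb : Splits B (blockSet T b)) {w : W}
    (hw : Sum.inl c ∈ B w) {v : Vertex T} (hv : v ∈ B w) :
    proj v ∈ side T (Sum.inr c) (Sum.inl b) := by
  refine (mem_side_or_mem_side hT.isTree h _).resolve_left fun hvs => ?_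
  have hc : proj (Sum.inl c : Vertex T) ∉ side T (Sum.inl b) (Sum.inr c) := self_notMem_side _ _
  obtain ⟨u, hu, z, -, huz, hus, hzs⟩ := exists_adj_boundary (hB.connected w)
    (A := {u | proj u ∈ side T (Sum.inl b) (Sum.inr c)}) hv hvs hw hc
  have hub := (hT.eq_inl_of_adj_of_mem_side h huz hus hzs).2
  rw [hb.eq_of_mem hB.disjoint (inl_mem_blockSet.2 h) hub hw hu] at hc
  exact hc hus

lemma proj_notMem_cutOff (hT : IsBlockCutTree T) (hB : IsMinorModel H (glued T) B) {w : W}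
    {v : Vertex T} (hv : v ∈ B w) : proj v ∉ cutOff B w := by
  intro hcut
  obtain ⟨f, ⟨hfw, hadj, hsplit⟩, hs⟩ := Set.mem_iUnion₂.1 hcut
  exact notMem_side (hT.mem_side_of_splits hB hadj hsplit hfw hv) hs

lemma exists_flag_of_adj (hT : IsBlockCutTree T) {w : W} {p q : I ⊕ C} (hpq : T.Adj p q)
    (hp : p ∈ cutOff B w) (hq : q ∉ cutOff B w) :
    ∃ f ∈ flags B w, p = Sum.inl f.2 ∧ q = Sum.inr f.1 := by
  obtain ⟨f, hf, hpf⟩ := Set.mem_iUnion₂.1 hp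
  have hqf := (mem_side_or_mem_side hT.isTree hf.2.1 q).resolve_left
    fun hs => hq (Set.mem_iUnion₂.2 ⟨f, hf, hs⟩)
  exact ⟨f, hf, BlockStructure.eq_of_adj_of_mem_side hT.isTree hf.2.1 hpq hpf hqf⟩

lemma pairwiseDisjoint_flags (hT : IsBlockCutTree T) (hB : IsMinorModel H (glued T) B) (w : W) :
    (flags B w).PairwiseDisjoint fun f => side T (Sum.inl f.2) (Sum.inr f.1) := by
  rintro f hf f' hf' hne
  refine disjoint_side hT.isTree hf.2.1 hf'.2.1 (hT.mem_side_of_splits hB hf.2.1 hf.2.2 hf.1 hf'.1)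
    (hT.mem_side_of_splits hB hf'.2.1 hf'.2.2 hf'.1 hf.1) fun hc hb => hne ?_
  exact Prod.ext (Sum.inr_injective hc) (Sum.inl_injective hb)

lemma exists_pair_avoiding [Finite C] (hT : IsBlockCutTree T) (b : I) {Z : Set (Vertex T)}
    (hZ : Z.ncard ≤ 2) (hZfin : Z.Finite) :
    ∃ i, ∀ t, (Sum.inr ⟨b, Sum.inr (i, t)⟩ : Vertex T) ∉ Z := by
  by_contra! h
  choose t ht using h
  obtain ⟨c, hc⟩ := hT.exists_adj_inl b
  have : Nonempty {c : C // T.Adj (Sum.inl b) (Sum.inr c)} := ⟨c, hc⟩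
  have hpos : 0 < Nat.card {c : C // T.Adj (Sum.inl b) (Sum.inr c)} := Nat.card_pos
  have := hZfin.to_subtype
  have hle := Nat.card_le_card_of_injective
    (fun i => (⟨Sum.inr ⟨b, Sum.inr (i, t i)⟩, ht i⟩ : Z)) fun i j hij => by
      simpa using And.left (by simpa using hij)
  rw [Nat.card_fin, Nat.card_coe_set_eq] at hle
  omega

lemma ncard_meets_flags_le [Finite I] [Finite C] (hT : IsBlockCutTree T)
    (hB : IsMinorModel H (glued T) B) (w : W) :
    (meets B (⋃ f ∈ flags B w, (glued T).neighborSet (Sum.inl f.1) ∩ blockSet T f.2)).ncard ≤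
      6 * (cutOff B w).ncard := by
  have hfin : (flags B w).Finite := Set.toFinite _
  calc _ ≤ (⋃ f ∈ flags B w, (glued T).neighborSet (Sum.inl f.1) ∩ blockSet T f.2).ncard :=
        ncard_meets_le hB.disjoint (Set.toFinite _)
    _ ≤ ∑ᶠ f ∈ flags B w, ((glued T).neighborSet (Sum.inl f.1) ∩ blockSet T f.2).ncard :=
        hfin.ncard_biUnion_le _
    _ = ∑ᶠ f ∈ flags B w, 6 * (side T (Sum.inl f.2) (Sum.inr f.1)).ncard :=
        finsum_mem_congr rfl fun f hf => hT.ncard_neighborSet_inter hf.2.1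
    _ = 6 * (cutOff B w).ncard := by
        rw [← mul_finsum_mem, cutOff, hfin.ncard_biUnion (fun _ _ => Set.toFinite _)
          (hT.pairwiseDisjoint_flags hB w)]

section Model

variable [Finite W] (hT : IsBlockCutTree T) (hB : IsMinorModel H (glued T) B)
  (hH : ∀ w, 6 * T.edgeSet.ncard ≤ (H.neighborSet w).ncard)
include hT hB hH

lemma lt_ncard_meets {b : I} {w : W} (hw : w ∈ meets B (blockSet T b))
    (h : ∀ c, T.Adj (Sum.inl b) (Sum.inr c) → Sum.inl c ∉ B w) :
    6 * T.edgeSet.ncard < (meets B (blockSet T b)).ncard := by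
  have hsub : insert w (H.neighborSet w) ⊆ meets B (blockSet T b) := by
    refine Set.insert_subset hw fun w' hw' => ?_
    obtain ⟨v, hv, hvb⟩ := hw
    have hs := hT.subset_blockSet (hB.connected w) hv hvb h
    obtain ⟨x, hx, y, hy, hxy⟩ := hB.exists_adj hw'
    rcases x with c | p
    · exact absurd hx (h c (inl_mem_blockSet.1 (hs hx)))
    · obtain rfl := hT.inr_mem_blockSet.1 (hs hx)
      exact mem_meets hy (hT.adj_inr.1 hxy).1
  refine lt_of_lt_of_le ?_ (Set.ncard_le_ncard hsub)
  rw [Set.ncard_insert_of_notMem (by simp)]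
  exact Nat.lt_succ_of_le (hH w)

variable [Finite I] [Finite C]

/-- At most two vertices of the block are not alone in their branch set, so some pair of mates is
alone in its branch sets `x` and `y`. Then `B x` is a single vertex, and `x` is joined to `d`
branch sets other than `x` and `y` that meet the block. Hence all `d + 2` vertices of the block are
in distinct branch sets. -/
lemma splits_of_forall_notMem {b : I} {w : W} (hw : w ∈ meets B (blockSet T b))
    (h : ∀ c, T.Adj (Sum.inl b) (Sum.inr c) → Sum.inl c ∉ B w) : Splits B (blockSet T b) := by
  have hlt := hT.lt_ncard_meets hB hH hw h
  have hcard := hT.ncard_blockSet b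
  have halone := ncard_not_alone_le hB.disjoint (Set.toFinite (blockSet T b))
  obtain ⟨i, hi⟩ := hT.exists_pair_avoiding b (halone.trans (by omega)) (Set.toFinite _)
  have hsingle (t) : ∃ w, B w ∩ blockSet T b = {Sum.inr ⟨b, Sum.inr (i, t)⟩} := by
    by_contra! hno
    exact hi t ⟨hT.inr_mem_blockSet.2 rfl, hno⟩
  obtain ⟨x, hx⟩ := hsingle true
  obtain ⟨y, hy⟩ := hsingle false
  have hxy : x ≠ y := by
    rintro rfl
    simp [hx] at hy
  have hpair : {x, y} ⊆ meets B (blockSet T b) :=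
    Set.pair_subset ⟨_, hx.ge rfl⟩ ⟨_, hy.ge rfl⟩
  have hsub : H.neighborSet x ⊆ meets B (blockSet T b) \ {x, y} := by
    intro w' hw'
    obtain ⟨u, hu, u', hu', huu'⟩ := hB.exists_adj hw'
    rw [hT.eq_singleton_of_inter_blockSet (p := ⟨b, _⟩) (hB.connected x) hx] at hu
    rw [Set.mem_singleton_iff.1 hu, hT.adj_inr] at huu'
    refine ⟨mem_meets hu' huu'.1, ?_⟩
    rintro (rfl | rfl)
    · exact H.loopless.irrefl _ hw'
    · exact huu'.2.2 (hy.le ⟨hu', huu'.1⟩)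
  have hle := (hH x).trans (Set.ncard_le_ncard hsub)
  have hsum := Set.ncard_sdiff_add_ncard_of_subset hpair
  rw [Set.ncard_pair hxy] at hsum
  exact splits_of_ncard_le hB.disjoint (Set.toFinite _) (by omega)

lemma inl_notMem_cutOff {b : I} {w : W} (hw : w ∈ meets B (blockSet T b))
    (hb : ¬ Splits B (blockSet T b)) : Sum.inl b ∉ cutOff B w := by
  intro hcut
  obtain ⟨c, hbc, hc⟩ : ∃ c, T.Adj (Sum.inl b) (Sum.inr c) ∧ Sum.inl c ∈ B w := by
    by_contra! hno
    exact hb (hT.splits_of_forall_notMem hB hH hw hno)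
  obtain ⟨f, hf, hbf, -⟩ := hT.exists_flag_of_adj hbc hcut (hT.proj_notMem_cutOff hB hc)
  exact hb (Sum.inl_injective hbf ▸ hf.2.2)

/-- A neighbour of `w` that it reaches through a block whose vertices are not in distinct branch
sets contains a cut-vertex of this block. -/
lemma neighborSet_subset {w : W} {c : C} (hcw : Sum.inl c ∈ B w) :
    H.neighborSet w ⊆
      meets B (⋃ f ∈ flags B w, (glued T).neighborSet (Sum.inl f.1) ∩ blockSet T f.2) ∪
        meets B (Sum.inl '' {c | Sum.inr c ∉ cutOff B w ∧ Sum.inl c ∉ B w}) := by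
  intro w' hw'
  obtain ⟨x, hx, y, hy, hxy⟩ := hB.exists_adj hw'
  obtain ⟨⟨b, hxb, hyb⟩, -⟩ := id hxy
  by_cases hb : Splits B (blockSet T b)
  · rcases x with c | p
    · exact Or.inl (mem_meets hy
        (Set.mem_iUnion₂.2 ⟨(c, b), ⟨hx, inl_mem_blockSet.1 hxb, hb⟩, hxy, hyb⟩))
    · obtain rfl := hT.inr_mem_blockSet.1 hxb
      obtain ⟨w₁, hw₁⟩ := hb _ hxb
      obtain rfl := eq_of_mem_of_mem hB.disjoint hx (hw₁.ge rfl).1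
      have hsingle := hT.eq_singleton_of_inter_blockSet (hB.connected w) hw₁
      exact absurd (hsingle.le hcw) Sum.inl_ne_inr
  · obtain ⟨c, hbc, hc⟩ : ∃ c, T.Adj (Sum.inl b) (Sum.inr c) ∧ Sum.inl c ∈ B w' := by
      by_contra! hno
      exact hb (hT.splits_of_forall_notMem hB hH (mem_meets hy hyb) hno)
    refine Or.inr (mem_meets hc ⟨c, ⟨fun hcut => ?_, fun hcw => ?_⟩, rfl⟩)
    · obtain ⟨f, -, hcf, -⟩ := hT.exists_flag_of_adj hbc.symm hcut
        (hT.inl_notMem_cutOff hB hH (mem_meets hx hxb) hb)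
      exact Sum.inr_ne_inl hcf
    · exact H.ne_of_adj hw' (eq_of_mem_of_mem hB.disjoint hcw hc)

lemma splits_of_mem {b : I} {c : C} {w : W} (hw : Sum.inl c ∈ B w)
    (h : T.Adj (Sum.inl b) (Sum.inr c)) : Splits B (blockSet T b) := by
  by_contra hb
  have hb' := hT.inl_notMem_cutOff hB hH (mem_meets hw (inl_mem_blockSet.2 h)) hb
  have hc' : Sum.inr c ∉ cutOff B w := hT.proj_notMem_cutOff hB hw
  have hrest : (meets B (Sum.inl '' {c | Sum.inr c ∉ cutOff B w ∧ Sum.inl c ∉ B w})).ncard ≤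
      ((cutOff B w)ᶜ \ {Sum.inl b, Sum.inr c}).ncard := by
    refine (ncard_meets_le hB.disjoint (Set.toFinite _)).trans ?_
    rw [Set.ncard_image_of_injective _ Sum.inl_injective, ← Set.ncard_image_of_injective _
      (Sum.inr_injective (α := I))]
    refine Set.ncard_le_ncard ?_
    rintro _ ⟨c₁, ⟨h₁, h₂⟩, rfl⟩
    refine ⟨h₁, ?_⟩
    rintro (h | h)
    · exact Sum.inr_ne_inl h
    · exact h₂ (Sum.inr_injective h ▸ hw)
  have hneighbors := (hH w).trans ((Set.ncard_le_ncard (hT.neighborSet_subset hB hH hw)).trans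
    (Set.ncard_union_le _ _))
  have hsum := Set.ncard_sdiff_add_ncard_of_subset (Set.pair_subset (s := (cutOff B w)ᶜ) hb' hc')
  rw [Set.ncard_pair Sum.inl_ne_inr] at hsum
  have := hT.ncard_meets_flags_le hB w
  have := Set.ncard_add_ncard_compl (cutOff B w)
  have := hT.ncard_edgeSet_add_one
  omega

lemma exists_splits [Nonempty W] : ∃ b, Splits B (blockSet T b) := by
  by_contra! hno
  have hcut : meets B (Set.range Sum.inl) = Set.univ := by
    refine Set.eq_univ_of_forall fun w => ?_
    obtain ⟨v, hv⟩ := hB.nonempty w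
    obtain ⟨b, hb⟩ := hT.exists_mem_blockSet v
    by_contra! hw
    exact hno b (hT.splits_of_forall_notMem hB hH (mem_meets hv hb)
      fun c _ hc => hw (mem_meets hc ⟨c, rfl⟩))
  have hWC := ncard_meets_le hB.disjoint (Set.finite_range (Sum.inl : C → Vertex T))
  rw [hcut, Set.ncard_univ, Set.ncard_range_of_injective Sum.inl_injective] at hWC
  obtain ⟨w⟩ := ‹Nonempty W›
  have hdeg := (hH w).trans (Set.ncard_le_card _)
  obtain ⟨c⟩ := hT.nonempty_cut
  have hI : 0 < Nat.card I := Nat.card_pos_iff.2 ⟨⟨(hT.exists_two c).choose⟩, inferInstance⟩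
  have := hT.ncard_edgeSet_add_one
  have := hT.ncard_edgeSet_pos
  have := Nat.card_sum (α := I) (β := C)
  omega

lemma forall_splits [Nonempty W] (b : I) : Splits B (blockSet T b) := by
  obtain ⟨b₀, hb₀⟩ := hT.exists_splits hB hH
  let A : Set (I ⊕ C) :=
    {x | ∃ b, Splits B (blockSet T b) ∧ (x = Sum.inl b ∨ T.Adj (Sum.inl b) x)}
  suffices hA : Sum.inl b ∈ A by
    obtain ⟨b', hb', hbb' | hbb'⟩ := hA
    · exact Sum.inl_injective hbb' ▸ hb'
    · exact absurd hbb' (hT.not_adj_inl _ _)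
  by_contra hb
  obtain ⟨p⟩ := hT.isTree.connected (Sum.inl b₀) (Sum.inl b)
  obtain ⟨⟨⟨x, y⟩, hxy⟩, -, ⟨b₁, hb₁, rfl | hbx⟩, hy⟩ :=
    p.exists_boundary_dart A ⟨b₀, hb₀, Or.inl rfl⟩ hb
  · exact hy ⟨b₁, hb₁, Or.inr hxy⟩
  rcases x with b' | c
  · exact hT.not_adj_inl _ _ hbx
  rcases y with b₂ | c'
  · obtain ⟨w, hw⟩ := hb₁.exists_mem (inl_mem_blockSet.2 hbx)
    exact hy ⟨b₂, hT.splits_of_mem hB hH hw hxy.symm, Or.inl rfl⟩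
  · exact hT.not_adj_inr _ _ hxy

lemma splits_univ [Nonempty W] : Splits B Set.univ := by
  intro v _
  obtain ⟨b, hb⟩ := hT.exists_mem_blockSet v
  obtain ⟨w, hw⟩ := (hT.forall_splits hB hH b).exists_mem hb
  refine ⟨w, Set.inter_univ _ ▸ Set.eq_singleton_iff_unique_mem.2 ⟨hw, fun x hx => ?_⟩⟩
  by_contra hne
  obtain ⟨u, hu, z, hz, ⟨⟨b', hub, hzb⟩, hzu, -⟩, rfl, -⟩ :=
    exists_adj_boundary (hB.connected w) hw (Set.mem_singleton v) hx hne
  exact hzu ((hT.forall_splits hB hH b').eq_of_mem hB.disjoint hub hzb hu hz)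

end Model

lemma memDHat_glued [Finite I] [Finite C] (hT : IsBlockCutTree T) :
    MemDHat (6 * T.edgeSet.ncard - 1) (glued T) := by
  classical
  have := Fintype.ofFinite (Vertex T)
  have hpos := hT.ncard_edgeSet_pos
  have : Nonempty (Vertex T) := hT.nonempty_cut.map Sum.inl
  refine memDHat_of_card_le (fun v => (hT.isRegularOfDegree_glued v).trans (by omega))
    fun W _ H _ hminor hlt => ?_
  obtain ⟨B, hB⟩ := isMinor_iff_exists_isMinorModel.1 hminor
  have : Nonempty W := by
    by_contra! hempty
    simp at hlt
  refine (hT.splits_univ hB fun w => ?_).card_le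
  rw [← Nat.card_coe_set_eq (H.neighborSet w), Nat.card_eq_fintype_card,
    SimpleGraph.card_neighborSet_eq_degree]
  have := H.minDegree_le_degree w
  omega

end IsBlockCutTree

end Minimality

/-! ### The block decomposition tree of the graph -/

section BlockTree

variable {I C : Type*} {T : SimpleGraph (I ⊕ C)}

variable (T) in
/-- The block `b` as a subgraph. -/
def blockSubgraph (b : I) : (glued T).Subgraph := (⊤ : (glued T).Subgraph).induce (blockSet T b)

lemma le_blockSubgraph {B : (glued T).Subgraph} {b : I} (h : B.verts ⊆ blockSet T b) :
    B ≤ blockSubgraph T b :=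
  ⟨h, fun _ _ huv => ⟨h (B.edge_vert huv), h (B.edge_vert huv.symm), B.adj_sub huv⟩⟩

namespace IsBlockCutTree

variable (hT : IsBlockCutTree T)
include hT

lemma eq_of_blockSet_subset {b b' : I} (h : blockSet T b ⊆ blockSet T b') : b = b' :=
  hT.inr_mem_blockSet.1 (h (hT.inr_mem_blockSet (p := ⟨b, Sum.inr (0, true)⟩) |>.2 rfl))

lemma blockSubgraph_injective : Function.Injective (blockSubgraph T) := fun _ _ h =>
  hT.eq_of_blockSet_subset (congrArg SimpleGraph.Subgraph.verts h).le

lemma connected_induce_of_forall_block {S : Set (Vertex T)} (hcut : ∀ c, Sum.inl c ∈ S)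
    (h : ∀ b, ((glued T).induce (S ∩ blockSet T b)).Connected) :
    ((glued T).induce S).Connected := by
  rw [connected_induce_iff_boundary]
  refine ⟨hT.nonempty_cut.elim fun c => ⟨_, hcut c⟩, ?_⟩
  rintro Z ⟨x, hx, hxZ⟩ ⟨y, hy, hyZ⟩
  by_contra hno
  have hblock : ∀ b, ∀ u ∈ S ∩ blockSet T b, u ∈ Z → S ∩ blockSet T b ⊆ Z := by
    intro b u hu huZ v hv
    by_contra hvZ
    obtain ⟨s, hs, t, ht, hst⟩ := exists_adj_boundary (h b) hu huZ hv hvZ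
    exact hno ⟨s, hs.1, t, ht.1, hst⟩
  let Q : I ⊕ C → Prop := Sum.elim (fun b => S ∩ blockSet T b ⊆ Z) (fun c => Sum.inl c ∈ Z)
  obtain ⟨b₀, hb₀⟩ := hT.exists_mem_blockSet x
  obtain ⟨b₁, hb₁⟩ := hT.exists_mem_blockSet y
  obtain ⟨p⟩ := hT.isTree.connected (Sum.inl b₀) (Sum.inl b₁)
  obtain ⟨⟨⟨s, t⟩, hadj⟩, -, hs, ht⟩ := p.exists_boundary_dart {t | Q t}
    (hblock b₀ x ⟨hx, hb₀⟩ hxZ) (fun hQ => hyZ (hQ ⟨hy, hb₁⟩))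
  rcases s with b | c <;> rcases t with b' | c'
  · exact hT.not_adj_inl _ _ hadj
  · exact ht (hs ⟨hcut c', inl_mem_blockSet.2 hadj⟩)
  · exact ht (hblock b' _ ⟨hcut c, inl_mem_blockSet.2 hadj.symm⟩ hs)
  · exact hT.not_adj_inr _ _ hadj

lemma isCutVertex_inl (hG : (glued T).Connected) (c : C) : IsCutVertex (glued T) (Sum.inl c) := by
  obtain ⟨b, b', hb, h, h'⟩ := hT.exists_two c
  have hinner (b : I) : (Sum.inr ⟨b, Sum.inr (0, true)⟩ : Vertex T) ∈ blockSet T b :=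
    hT.inr_mem_blockSet.2 rfl
  exact isCutVertex_of_boundary hG (A := {v | proj v ∈ side T (Sum.inl b) (Sum.inr c)})
    (fun _ hx _ hy hxy => (hT.eq_inl_of_adj_of_mem_side h hxy hx hy).1)
    (hT.mem_side_of_mem_blockSet h (hinner b) Sum.inr_ne_inl) Sum.inr_ne_inl
    (hT.notMem_side_of_mem_blockSet hb h h' (hinner b')) Sum.inr_ne_inl

lemma exists_mem_side_of_notMem_blockSet {b : I} {v : Vertex T} (hv : v ∉ blockSet T b) :
    ∃ c b', b' ≠ b ∧ T.Adj (Sum.inl b) (Sum.inr c) ∧ T.Adj (Sum.inl b') (Sum.inr c) ∧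
      proj v ∈ side T (Sum.inl b') (Sum.inr c) := by
  obtain ⟨b₁ | c, hbc, hvc⟩ := exists_adj_mem_side hT.isTree (fun h => hv (Or.inl h))
  · exact absurd hbc (hT.not_adj_inl _ _)
  obtain ⟨b' | c', hcb', hvb'⟩ := exists_adj_mem_side hT.isTree (x := proj v) (v := Sum.inr c)
    (fun h => hv (proj_eq_inr.1 h ▸ inl_mem_blockSet.2 hbc))
  · refine ⟨c, b', ?_, hbc, hcb'.symm, hvb'⟩
    rintro rfl
    exact notMem_side hvc hvb'
  · exact absurd hcb' (hT.not_adj_inr _ _)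

lemma exists_subset_blockSet {B : (glued T).Subgraph} (hB : IsTwoConnected B) :
    ∃ b, B.verts ⊆ blockSet T b := by
  obtain ⟨x, hx, y, hy, ⟨b, hxb, hyb⟩, hxy, -⟩ := hB.exists_adj
  refine ⟨b, fun v hv => ?_⟩
  by_contra hvb
  obtain ⟨c, b', hb, h, h', hvs⟩ := hT.exists_mem_side_of_notMem_blockSet hvb
  have hvc : v ≠ Sum.inl c := by
    rintro rfl
    exact hvb (inl_mem_blockSet.2 h)
  have hsub := hB.verts_subset_of_boundary
    (A := {v | proj v ∈ side T (Sum.inl b') (Sum.inr c)})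
    (fun _ hx _ hy hxy => (hT.eq_inl_of_adj_of_mem_side h' hxy hx hy).1) hv hvs hvc
  have heq {u : Vertex T} (hu : u ∈ B.verts) (hub : u ∈ blockSet T b) : u = Sum.inl c :=
    (hsub hu).resolve_right (hT.notMem_side_of_mem_blockSet hb h' h hub)
  exact hxy ((heq hx hxb).trans (heq hy hyb).symm)

variable [Finite C]

/-- A vertex and its mate are both joined to all vertices other than these two, also to one of
another pair. -/
lemma connected_induce_inter_blockSet {b : I} {S : Set (Vertex T)}
    (hS : (blockSet T b \ S).Subsingleton) : ((glued T).induce (S ∩ blockSet T b)).Connected := by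
  have hcard : (blockSet T b \ S).ncard ≤ 1 :=
    (Set.ncard_le_one hS.finite).2 fun _ hx _ hy => hS hx hy
  have hmem {k t} (hk : (Sum.inr ⟨b, Sum.inr (k, t)⟩ : Vertex T) ∉ blockSet T b \ S) :
      (Sum.inr ⟨b, Sum.inr (k, t)⟩ : Vertex T) ∈ S ∩ blockSet T b :=
    ⟨by_contra fun h => hk ⟨hT.inr_mem_blockSet.2 rfl, h⟩, hT.inr_mem_blockSet.2 rfl⟩
  obtain ⟨i, hi⟩ := hT.exists_pair_avoiding b (hcard.trans one_le_two) hS.finite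
  obtain ⟨j, hj⟩ := hT.exists_pair_avoiding b
    (Z := insert (Sum.inr ⟨b, Sum.inr (i, true)⟩) (blockSet T b \ S))
    ((Set.ncard_insert_le _ _).trans (by omega)) (hS.finite.insert _)
  have hij : j ≠ i := fun h => hj true (h ▸ Set.mem_insert _ _)
  have hadj (s : Bool) : ((glued T).induce (S ∩ blockSet T b)).Adj
      ⟨_, hmem (hi s)⟩ ⟨_, hmem fun h => hj true (Set.mem_insert_of_mem _ h)⟩ := by
    refine hT.adj_inr.2 ⟨hT.inr_mem_blockSet.2 rfl, ?_, ?_⟩ <;> simp [mate, hij]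
  rw [SimpleGraph.connected_iff_exists_forall_reachable]
  refine ⟨⟨_, hmem (hi true)⟩, ?_⟩
  rintro ⟨v, hv⟩
  by_cases h1 : v = Sum.inr ⟨b, Sum.inr (i, true)⟩
  · subst h1
    rfl
  by_cases h2 : v = Sum.inr ⟨b, Sum.inr (i, false)⟩
  · subst h2
    exact (hadj true).reachable.trans (hadj false).symm.reachable
  · exact SimpleGraph.Adj.reachable (hT.adj_inr.2 ⟨hv.2, h1, h2⟩)

lemma connected_glued : (glued T).Connected := by
  refine (SimpleGraph.induceUnivIso (glued T)).connected_iff.1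
    (hT.connected_induce_of_forall_block (fun _ => trivial)
      fun b => hT.connected_induce_inter_blockSet ?_)
  rw [Set.sdiff_univ]
  exact Set.subsingleton_empty

lemma isCutVertex_iff {v : Vertex T} : IsCutVertex (glued T) v ↔ ∃ c, v = Sum.inl c := by
  constructor
  · rintro ⟨a, a', -, h⟩
    by_contra! hv
    refine h ((hT.connected_induce_of_forall_block (fun c => (hv c).symm)
      fun b => hT.connected_induce_inter_blockSet ?_).preconnected a a')
    rw [Set.sdiff_compl]
    exact Set.subsingleton_singleton.anti Set.inter_subset_right
  · rintro ⟨c, rfl⟩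
    exact hT.isCutVertex_inl hT.connected_glued c

lemma vertexConnectivity_glued : vertexConnectivity (glued T) = 1 :=
  hT.nonempty_cut.elim fun c =>
    vertexConnectivity_eq_one hT.connected_glued (hT.isCutVertex_inl hT.connected_glued c)

lemma not_isBridge {u v : Vertex T} (h : (glued T).Adj u v) : ¬ (glued T).IsBridge s(u, v) := by
  obtain ⟨⟨b, hub, hvb⟩, -⟩ := h
  obtain ⟨i, hi⟩ := hT.exists_pair_avoiding b (Z := {u, v})
    (by simpa using Set.ncard_insert_le u {v}) (Set.toFinite _)
  simp only [Set.mem_insert_iff, Set.mem_singleton_iff, not_or, ← ne_eq] at hi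
  have hu : (glued T).Adj (Sum.inr ⟨b, Sum.inr (i, true)⟩) u :=
    hT.adj_inr.2 ⟨hub, (hi true).1.symm, (hi false).1.symm⟩
  have hv : (glued T).Adj (Sum.inr ⟨b, Sum.inr (i, true)⟩) v :=
    hT.adj_inr.2 ⟨hvb, (hi true).2.symm, (hi false).2.symm⟩
  rw [SimpleGraph.isBridge_iff, not_not]
  refine (SimpleGraph.Adj.reachable (v := Sum.inr ⟨b, Sum.inr (i, true)⟩) ?_).trans
    (SimpleGraph.Adj.reachable ?_)
  · rw [SimpleGraph.deleteEdges_adj]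
    exact ⟨hu.symm, fun h => (hi true).2 (Sym2.congr_right.1 h)⟩
  · rw [SimpleGraph.deleteEdges_adj]
    exact ⟨hv, fun h => (hi true).1 (Sym2.congr_left.1 h)⟩

variable [Finite I]

lemma isTwoConnected_blockSubgraph (b : I) : IsTwoConnected (blockSubgraph T b) := by
  have hconn {S : Set (Vertex T)} (hSb : S ⊆ blockSet T b)
      (hS : (blockSet T b \ S).Subsingleton) :
      ((⊤ : (glued T).Subgraph).induce S).Connected := by
    rw [← SimpleGraph.connected_induce_iff, ← Set.inter_eq_left.2 hSb]
    exact hT.connected_induce_inter_blockSet hS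
  refine ⟨?_, hconn subset_rfl ?_, fun x _ => ?_⟩
  · have hcard := hT.ncard_blockSet b
    have hpos := hT.ncard_edgeSet_pos
    change 3 ≤ (blockSet T b).encard
    rw [← (Set.toFinite (blockSet T b)).cast_ncard_eq]
    exact_mod_cast (by omega : 3 ≤ (blockSet T b).ncard)
  · rw [Set.sdiff_self]
    exact Set.subsingleton_empty
  · have hdel : (blockSubgraph T b).deleteVerts {x} =
        (⊤ : (glued T).Subgraph).induce (blockSet T b \ {x}) := by
      ext u v
      · rfl
      · simp only [blockSubgraph, SimpleGraph.Subgraph.induce_adj,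
          SimpleGraph.Subgraph.induce_verts, Set.mem_sdiff]
        tauto
    rw [hdel]
    refine hconn Set.sdiff_subset ?_
    rw [Set.sdiff_sdiff_right_self]
    exact Set.subsingleton_singleton.anti Set.inter_subset_right

lemma isBlock_iff {B : (glued T).Subgraph} :
    IsBlock (glued T) B ↔ ∃ b, B = blockSubgraph T b := by
  constructor
  · rintro (⟨x, y, h, hb, -⟩ | hB)
    · exact absurd hb (hT.not_isBridge h)
    · obtain ⟨b, hb⟩ := hT.exists_subset_blockSet hB.prop
      exact ⟨b, hB.eq_of_le (hT.isTwoConnected_blockSubgraph b) (le_blockSubgraph hb)⟩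
  · rintro ⟨b, rfl⟩
    refine Or.inr ⟨hT.isTwoConnected_blockSubgraph b, fun B hB hle => ?_⟩
    obtain ⟨b', hb'⟩ := hT.exists_subset_blockSet hB
    obtain rfl : b = b' := hT.eq_of_blockSet_subset (hle.1.trans hb')
    exact le_blockSubgraph hb'

lemma nonempty_iso_blockTree : Nonempty (T ≃g blockTree (glued T)) := by
  let e₁ : I → {B : (glued T).Subgraph // IsBlock (glued T) B} :=
    fun b => ⟨blockSubgraph T b, hT.isBlock_iff.2 ⟨b, rfl⟩⟩
  have he₁ : Function.Bijective e₁ := by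
    refine ⟨fun b b' h => hT.blockSubgraph_injective (congrArg Subtype.val h), ?_⟩
    rintro ⟨B, hB⟩
    obtain ⟨b, rfl⟩ := hT.isBlock_iff.1 hB
    exact ⟨b, rfl⟩
  let e₂ : C → {v : Vertex T // IsCutVertex (glued T) v} :=
    fun c => ⟨Sum.inl c, hT.isCutVertex_iff.2 ⟨c, rfl⟩⟩
  have he₂ : Function.Bijective e₂ := by
    refine ⟨fun c c' h => Sum.inl_injective (congrArg Subtype.val h), ?_⟩
    rintro ⟨v, hv⟩
    obtain ⟨c, rfl⟩ := hT.isCutVertex_iff.1 hv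
    exact ⟨c, rfl⟩
  refine ⟨⟨Equiv.sumCongr (Equiv.ofBijective e₁ he₁) (Equiv.ofBijective e₂ he₂), ?_⟩⟩
  rintro (b | c) (b' | c')
  · exact iff_of_false id (hT.not_adj_inl _ _)
  · exact inl_mem_blockSet
  · exact inl_mem_blockSet.trans (T.adj_comm _ _)
  · exact iff_of_false id (hT.not_adj_inr _ _)

lemma isBlockTreeOf_glued : IsBlockTreeOf T (glued T) :=
  ⟨hT.connected_glued, hT.nonempty_iso_blockTree⟩

end IsBlockCutTree

end BlockTree

/-! ### Trees with one vertex -/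

section OneVertex

variable {V : Type*}

lemma not_isCutVertex_top (c : V) : ¬ IsCutVertex (⊤ : SimpleGraph V) c := by
  rintro ⟨a, b, -, h⟩
  obtain rfl | hab := eq_or_ne a b
  · exact h .rfl
  · exact h (SimpleGraph.Adj.reachable fun h => hab (Subtype.ext h))

lemma isBlock_top_iff (hV : Nat.card V = 2) {B : (⊤ : SimpleGraph V).Subgraph} :
    IsBlock ⊤ B ↔ B = ⊤ := by
  have := Nat.finite_of_card_ne_zero (hV.trans_ne two_ne_zero)
  have hB {B : (⊤ : SimpleGraph V).Subgraph} (hB : IsBlock ⊤ B) : B = ⊤ := by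
    obtain ⟨x, y, h, -, rfl⟩ | hB := hB
    · have huniv : ({x, y} : Set V) = Set.univ := by
        rw [Set.eq_univ_iff_ncard, Set.ncard_pair h, hV]
      have hmem (v : V) : v = x ∨ v = y := huniv.ge (Set.mem_univ v)
      ext u v
      · exact iff_of_true (hmem u) trivial
      · refine ⟨SimpleGraph.Subgraph.adj_sub _, fun huv : u ≠ v => ?_⟩
        rcases hmem u with rfl | rfl <;> rcases hmem v with rfl | rfl
        · exact absurd rfl huv
        · exact rfl
        · exact Sym2.eq_swap
        · exact absurd rfl huv
    · have hcard := hB.prop.1.trans (Set.encard_le_encard (Set.subset_univ _))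
      rw [Set.encard_univ, ENat.card_eq_coe_natCard, hV] at hcard
      exact absurd hcard (by norm_num)
  refine ⟨hB, ?_⟩
  rintro rfl
  obtain ⟨x, y, hxy, -⟩ := Nat.card_eq_two_iff.1 hV
  obtain ⟨B, hblock, -⟩ := exists_isBlock_adj (G := (⊤ : SimpleGraph V)) hxy
  exact hB hblock ▸ hblock

lemma isBlockTreeOf_top (hV : Nat.card V = 2) {U : Type*} [Nonempty U] [Subsingleton U]
    (T : SimpleGraph U) : IsBlockTreeOf T (⊤ : SimpleGraph V) := by
  have : Nonempty V := (Nat.card_pos_iff.1 (hV ▸ two_pos)).1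
  have : IsEmpty {c : V // IsCutVertex ⊤ c} := ⟨fun c => not_isCutVertex_top c.1 c.2⟩
  have : Unique {B : (⊤ : SimpleGraph V).Subgraph // IsBlock ⊤ B} :=
    ⟨⟨⟨⊤, (isBlock_top_iff hV).2 rfl⟩⟩, fun B => Subtype.ext ((isBlock_top_iff hV).1 B.2)⟩
  obtain ⟨_⟩ := nonempty_unique U
  let e : U ≃ {B : (⊤ : SimpleGraph V).Subgraph // IsBlock ⊤ B} ⊕ {c : V // IsCutVertex ⊤ c} :=
    (Equiv.ofUnique _ _).trans (Equiv.sumEmpty _ _).symm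
  refine ⟨SimpleGraph.connected_top, ⟨⟨e, fun {a b} => ?_⟩⟩⟩
  rw [Subsingleton.elim a b]
  exact iff_of_false (SimpleGraph.irrefl _) (SimpleGraph.irrefl _)

lemma memDHat_top {k : ℕ} (hV : Nat.card V = k + 2) : MemDHat k (⊤ : SimpleGraph V) := by
  classical
  have : Finite V := Nat.finite_of_card_ne_zero (by omega)
  have : Nonempty V := Finite.card_pos_iff.1 (by omega)
  have := Fintype.ofFinite V
  have hreg : (⊤ : SimpleGraph V).IsRegularOfDegree (k + 1) := fun v => by
    rw [SimpleGraph.IsRegularOfDegree.top v, ← Nat.card_eq_fintype_card, hV, Nat.add_succ_sub_one]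
  refine memDHat_of_card_le hreg fun W _ H _ _ hH => ?_
  have : Nonempty W := by
    by_contra! hW
    exact hH.not_ge (H.minDegree_of_subsingleton.trans_le k.zero_le)
  rw [hV, Nat.card_eq_fintype_card]
  exact (Nat.succ_le_of_lt hH).trans_lt H.minDegree_lt_card

end OneVertex

/-! ### Arbitrary block decomposition trees -/

lemma isBlockCutTree_blockTree {V : Type*} {G : SimpleGraph V} (hG : G.Connected)
    (hT : (blockTree G).IsTree) (hne : (blockTree G).edgeSet.Nonempty) :
    IsBlockCutTree (blockTree G) where
  isTree := hT
  not_adj_inl _ _ := id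
  not_adj_inr _ _ := id
  exists_two := by
    rintro ⟨c, hc⟩
    obtain ⟨B₁, B₂, h₁, h₂, h, hc₁, hc₂⟩ := hc.exists_two_blocks hG
    exact ⟨⟨B₁, h₁⟩, ⟨B₂, h₂⟩, fun h' => h (congrArg Subtype.val h'), hc₁, hc₂⟩
  nonempty_cut := by
    obtain ⟨⟨B | c, B' | c'⟩, h⟩ := hne
    exacts [h.elim, ⟨c'⟩, ⟨c⟩, ⟨c⟩]

lemma subsingleton_of_isTree {V : Type*} {T : SimpleGraph V} (hT : T.IsTree)
    (hne : ¬ T.edgeSet.Nonempty) : Subsingleton V := by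
  rw [Set.not_nonempty_iff_eq_empty, SimpleGraph.edgeSet_eq_empty] at hne
  exact SimpleGraph.preconnected_bot_iff_subsingleton.1 (hne ▸ hT.connected.preconnected)

lemma IsBlockTreeOf.congr_left {U V W : Type*} {S : SimpleGraph U} {T : SimpleGraph V}
    {G : SimpleGraph W} (e : S ≃g T) (h : IsBlockTreeOf T G) : IsBlockTreeOf S G :=
  ⟨h.1, h.2.map e.trans⟩

end BlockStructure

open BlockStructure in
theorem mainTheorem4_general.{u, v} {V : Type u} [Finite V] (T : SimpleGraph V) (hT : T.IsTree)
    {U : Type v} {H : SimpleGraph U} (hH : IsBlockTreeOf T H) :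
    ∃ (W : Type v) (_ : Fintype W) (G : SimpleGraph W) (_ : DecidableRel G.Adj),
      IsBlockTreeOf T G ∧
      G.IsRegularOfDegree (max 1 (6 * T.edgeSet.ncard)) ∧
      MemDHat (max 1 (6 * T.edgeSet.ncard) - 1) G ∧
      (T.edgeSet.Nonempty → vertexConnectivity G = 1) := by
  classical
  by_cases hne : T.edgeSet.Nonempty
  · obtain ⟨hconn, ⟨e⟩⟩ := hH
    have : Finite ({B // IsBlock H B} ⊕ {c // IsCutVertex H c}) := Finite.of_equiv _ e.toEquiv
    have := Finite.sum_left {c // IsCutVertex H c} (α := {B // IsBlock H B})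
    have := Finite.sum_right {B // IsBlock H B} (β := {c // IsCutVertex H c})
    have hBT : IsBlockCutTree (blockTree H) := isBlockCutTree_blockTree hconn (e.isTree_iff.1 hT)
      (Set.nonempty_coe_sort.1 ((e.mapEdgeSet.nonempty_congr).1 hne.to_subtype))
    have hcard : T.edgeSet.ncard = (blockTree H).edgeSet.ncard := Nat.card_congr e.mapEdgeSet
    have := Fintype.ofFinite (Vertex (blockTree H))
    rw [hcard, max_eq_right (by have := hBT.ncard_edgeSet_pos; omega)]
    exact ⟨_, inferInstance, glued (blockTree H), inferInstance,
      hBT.isBlockTreeOf_glued.congr_left e, hBT.isRegularOfDegree_glued, hBT.memDHat_glued,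
      fun _ => hBT.vertexConnectivity_glued⟩
  · have := hT.connected.nonempty
    have := subsingleton_of_isTree hT hne
    have hcard : Nat.card (ULift.{v} Bool) = 0 + 2 := by simp
    rw [Set.not_nonempty_iff_eq_empty.1 hne, Set.ncard_empty]
    exact ⟨ULift Bool, inferInstance, ⊤, inferInstance, isBlockTreeOf_top hcard T,
      SimpleGraph.IsRegularOfDegree.top, memDHat_top hcard,
      fun h => absurd h Set.not_nonempty_empty⟩

theorem mainTheorem4 {V : Type*} (T : SimpleGraph V)
    (hT : BlockStructure.IsBlockDecompositionTree T) :
    ∃ (W : Type) (_ : Fintype W) (G : SimpleGraph W) (_ : DecidableRel G.Adj),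
      BlockStructure.IsBlockTreeOf T G ∧
      (∃ k : ℕ, G.minDegree = k + 1 ∧ BlockStructure.MemDHat k G) ∧
      (T.edgeSet.Nonempty →
        G.minDegree ≤ 8 * T.edgeSet.ncard ∧ BlockStructure.vertexConnectivity G = 1) := by
  obtain ⟨hTree, U, _, H, hconn, ⟨e⟩⟩ := hT
  have : Finite V := Finite.of_equiv _ e.symm.toEquiv
  obtain ⟨W, _, G, _, hG, hreg, hD, hκ⟩ := mainTheorem4_general T hTree ⟨hconn, ⟨e⟩⟩
  have := hG.1.nonempty
  have hdeg := hreg.minDegree_eq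
  refine ⟨W, _, G, _, hG, ⟨_, by omega, hD⟩, fun hne => ⟨?_, hκ hne⟩⟩
  have := (Set.ncard_pos).2 hne
  omega
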